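/- **Setting.** A vocabulary is a set of predicate constants and function constants of finite arities (nullary predicates are propositions, nullary functions are individual constants). A structure has a nonempty domain. A *rule* is an expression $$\zeta_1\wedge\cdots\wedge\zeta_m\rightarrow\zeta_{m+1}\vee\cdots\vee\zeta_n\qquad(0\le m\le n,\ n>0),$$ where $\zeta_1,\dots,\zeta_m$ (the body) are literals, i.e. atoms (possibly equations) or negations of atoms, and $\zeta_{m+1},\dots,\zeta_n$ (the head) are atoms not involving equality. A *disjunctive program* is a finite set of rules; it is *normal* if the head of each rule contains at most one atom. For a disjunctive program $\Pi$, let $\tau$ be the (finite) set of intensional predicates, i.e. those appearing in the head of some rule; let $\varphi$ be the conjunction of the universal closures of the rules of $\Pi$; for each $P\in\tau$ let $P^*$ be a fresh predicate variable of the same arity, and let $\varphi^*$ be obtained from $\varphi$ by replacing each positive (i.e. non-negated) occurrence of each $P\in\tau$ in the head or the body of a rule by $P^*$. Put $$\mathrm{SM}(\Pi)=\varphi\wedge\forall\tau^*(\tau^*<\tau\rightarrow\neg\varphi^*),$$ where $\tau^*=\{P^*\mid P\in\tau\}$ and $\tau^*<\tau$ denotes $\bigwedge_{P\in\tau}\forall\bar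 x(P^*(\bar x)\rightarrow P(\bar x))\wedge\neg\bigwedge_{P\in\tau}\forall\bar x(P(\bar x)\rightarrow P^*(\bar x))$. Let $\mathrm{DLP}$ (respectively $\mathrm{NLP}$) be the class of all second-order sentences $\exists\sigma\,\mathrm{SM}(\Pi)$, where $\Pi$ is a disjunctive (respectively normal) program and $\sigma$ is a finite set of predicate constants. For a class $\mathcal C$ of structures and classes $\Sigma,\Lambda$ of sentences, write $\Sigma\le_{\mathcal C}\Lambda$ if, for every vocabulary $\upsilon$ and every class $\mathcal D$ of $\upsilon$-structures, whenever some sentence of $\Sigma$ whose free constants all lie in $\upsilon$ defines $\mathcal D$ over $\mathcal C$ (that is, a $\upsilon$-structure in $\mathcal C$ belongs to $\mathcal D$ iff it satisfies the sentence), so does some sentence of $\Lambda$ whose free constants all lie in $\upsilon$. Write $\Sigma\simeq_{\mathcal C}\Lambda$ if $\Sigma\le_{\mathcal C}\Lambda$ and $\Lambda\le_{\mathcal C}\Sigma$, and drop the subscript if $\mathcal C$ is the class of all structures. Let $\mathsf{FIN}$ be the class of structures with finite domain. **Theorem.** $\mathrm{DLP}\simeq\mathrm{NLP}$ if and only if $\mathrm{DLP}\simeq_{\mathsf{FIN}}\mathrm{NLP}$.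 -/

import Mathlib

universe u v w

namespace LogicProgram

/-! Vocabularies are first-order languages (`FirstOrder.Language`, relation and function symbols
of arbitrary finite arity, including propositions and individual constants). Individual variables
are indexed by `ℕ`. -/

/-- An atom `P(t₁,…,tₙ)` not involving equality. -/
structure PredAtom (L : FirstOrder.Language.{u, v}) where
  arity : ℕ
  pred : L.Relations arity
  args : Fin arity → L.Term ℕ

/-- An atom: either a predicate atom or an equation between terms. -/
inductive Atom (L : FirstOrder.Language.{u, v}) where
  | pred (a : PredAtom L)
  | eq (s t : L.Term ℕ)

/-- A literal: an atom or the negation of an atom. -/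
inductive Literal (L : FirstOrder.Language.{u, v}) where
  | pos (a : Atom L)
  | neg (a : Atom L)

/-- A rule `ζ₁ ∧ ⋯ ∧ ζₘ → ζₘ₊₁ ∨ ⋯ ∨ ζₙ` with `0 ≤ m ≤ n` and `n > 0`: body literals, and head
atoms that do not involve equality. -/
structure Rule (L : FirstOrder.Language.{u, v}) where
  body : List (Literal L)
  head : List (PredAtom L)
  nonempty : 0 < body.length + head.length

/-- A (possibly infinite) disjunctive program; finiteness is imposed in `DLP` and `NLP`. -/
abbrev Program (L : FirstOrder.Language.{u, v}) := Set (Rule L)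

/-- A program is normal if every head contains at most one atom. -/
def Program.IsNormal {L : FirstOrder.Language.{u, v}} (P : Program L) : Prop :=
  ∀ r ∈ P, r.head.length ≤ 1

/-- A predicate is intensional if it appears in the head of some rule. -/
def Program.Intensional {L : FirstOrder.Language.{u, v}} (P : Program L) {n : ℕ}
    (R : L.Relations n) : Prop :=
  ∃ r ∈ P, ∃ args : Fin n → L.Term ℕ, (⟨n, R, args⟩ : PredAtom L) ∈ r.head

/-- An interpretation of all predicate symbols of `L` by relations on `M`. -/
abbrev PredInterp (L : FirstOrder.Language.{u, v}) (M : Type w) :=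
  ∀ n : ℕ, L.Relations n → (Fin n → M) → Prop

section Semantics

variable {L : FirstOrder.Language.{u, v}} {M : Type w} [L.Structure M]

/-- Truth of a predicate atom when predicates are read in `I` and terms in the structure. -/
def PredAtom.Holds (a : PredAtom L) (I : PredInterp L M) (s : ℕ → M) : Prop :=
  I a.arity a.pred (fun i => (a.args i).realize s)

/-- Truth of an atom when predicates are read in `I` and terms in the structure. -/
def Atom.Holds (I : PredInterp L M) (s : ℕ → M) : Atom L → Prop
  | .pred a => a.Holds I s
  | .eq t₁ t₂ => t₁.realize s = t₂.realize s

/-- Truth of a literal when positive occurrences of predicates are read in `I` and negated ones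
in `J`. -/
def Literal.Holds (I J : PredInterp L M) (s : ℕ → M) : Literal L → Prop
  | .pos a => a.Holds I s
  | .neg a => ¬ a.Holds J s

/-- Truth of the universal closure of a rule when positive occurrences of predicates (in the head
or in the body) are read in `I` and negated ones in `J`. -/
def Rule.Holds (r : Rule L) (I J : PredInterp L M) : Prop :=
  ∀ s : ℕ → M, (∀ l ∈ r.body, l.Holds I J s) → ∃ a ∈ r.head, a.Holds I s

variable (L M) in
/-- The interpretation of the predicates given by the structure itself. -/
def structInterp : PredInterp L M := fun _ R x => FirstOrder.Language.Structure.RelMap R x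

/-- The reading of positive occurrences in `φ*`: an intensional predicate `R` is replaced by the
predicate variable `R*`, whose value is `X R`; all other predicates keep their meaning. -/
def Program.starInterp (P : Program L) (X : PredInterp L M) : PredInterp L M := fun n R x =>
  (P.Intensional R ∧ X n R x) ∨ (¬ P.Intensional R ∧ structInterp L M n R x)

/-- The formula `τ* < τ`, where `τ` is the set of intensional predicates and `X` gives the values
of the predicate variables `τ*`. -/
def Program.StarLess (P : Program L) (X : PredInterp L M) : Prop :=
  (∀ (n : ℕ) (R : L.Relations n), P.Intensional R →
      ∀ x : Fin n → M, X n R x → structInterp L M n R x) ∧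
  ¬ (∀ (n : ℕ) (R : L.Relations n), P.Intensional R →
      ∀ x : Fin n → M, structInterp L M n R x → X n R x)

variable (M) in
/-- `M` satisfies `SM(P) = φ ∧ ∀ τ* (τ* < τ → ¬ φ*)`, i.e. `M` is a stable model of `P`. -/
def Program.StableModel (P : Program L) : Prop :=
  (∀ r ∈ P, r.Holds (structInterp L M) (structInterp L M)) ∧
  ∀ X : PredInterp L M, P.StarLess X →
    ¬ ∀ r ∈ P, r.Holds (P.starInterp X) (structInterp L M)

end Semantics

/-- A structure of the vocabulary `L`, with nonempty domain. -/
structure Struct (L : FirstOrder.Language.{u, v}) where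
  carrier : Type w
  [nonempty : Nonempty carrier]
  [str : L.Structure carrier]

attribute [instance] Struct.nonempty Struct.str

/-- A sentence `∃ τ SM(P)` of the vocabulary `L`: `τ` is a finite set of auxiliary predicate
constants (the symbols of the relational language `aux`) and all other constants of `P` are
in `L`. -/
structure ProgSentence (L : FirstOrder.Language.{u, v}) where
  aux : FirstOrder.Language.{0, 0}
  aux_relational : aux.IsRelational
  aux_finite : Finite (Σ n, aux.Relations n)
  program : Program (L.sum aux)

/-- `A ⊨ ∃ τ SM(P)`: some expansion of `A` by an interpretation of `τ` is a stable model of `P`. -/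
def ProgSentence.Models {L : FirstOrder.Language.{u, v}} (A : Struct.{u, v, w} L)
    (φ : ProgSentence L) : Prop :=
  ∃ _ : φ.aux.Structure A.carrier, φ.program.StableModel A.carrier

/-- A class of sentences `∃ τ SM(P)`, listed by vocabulary. -/
abbrev SentenceClass := ∀ L : FirstOrder.Language.{u, v}, Set (ProgSentence L)

/-- A class of structures, listed by vocabulary. -/
abbrev StructClass := ∀ L : FirstOrder.Language.{u, v}, Set (Struct.{u, v, w} L)

/-- The sentences `∃ τ SM(P)` with `P` a finite disjunctive program. -/
def DLP : SentenceClass.{u, v} := fun _ => {φ | φ.program.Finite}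

/-- The sentences `∃ τ SM(P)` with `P` a finite normal program. -/
def NLP : SentenceClass.{u, v} := fun _ => {φ | φ.program.Finite ∧ φ.program.IsNormal}

/-- The class of all structures. -/
def ARB : StructClass.{u, v, w} := fun _ => Set.univ

/-- The class of finite structures. -/
def FIN : StructClass.{u, v, w} := fun _ => {A | Finite A.carrier}

/-- The property `D` of structures of the vocabulary `L` is defined by `φ` over `C`. -/
def Defines {L : FirstOrder.Language.{u, v}} (C : StructClass.{u, v, w}) (φ : ProgSentence L)
    (D : Set (Struct.{u, v, w} L)) : Prop :=
  ∀ A ∈ C L, A ∈ D ↔ φ.Models A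

/-- The property `D` is definable in the class `S` of sentences over `C`. -/
def Definable {L : FirstOrder.Language.{u, v}} (C : StructClass.{u, v, w})
    (S : SentenceClass.{u, v}) (D : Set (Struct.{u, v, w} L)) : Prop :=
  ∃ φ ∈ S L, Defines C φ D

/-- `S ≤_C T`: each property definable in `S` over `C` is also definable in `T` over `C`. -/
def ExprLE (C : StructClass.{u, v, w}) (S T : SentenceClass.{u, v}) : Prop :=
  ∀ (L : FirstOrder.Language.{u, v}) (D : Set (Struct.{u, v, w} L)),
    Definable C S D → Definable C T D

/-- `S ≃_C T`: both `S ≤_C T` and `T ≤_C S`. -/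
def ExprEquiv (C : StructClass.{u, v, w}) (S T : SentenceClass.{u, v}) : Prop :=
  ExprLE C S T ∧ ExprLE C T S

end LogicProgram

/-! Only one direction needs work: turning a disjunctive `φ` (program `P`) and a normal `ψ` (program
`Q`) that agree on finite structures into one normal sentence equivalent to `φ` everywhere. Its
program guesses a proposition `flag`.

With `flag`, the program certifies finiteness and checks `Q`. Finiteness holds when some functional
graph `next` has a transitive closure containing every pair; the closure is an intensional
predicate, so stability makes it least. To check `Q`, its predicates are guessed, copies of the
intensional ones are generated from the reduct, and copy and guess are required to coincide. Copies
are needed because an intensional predicate of `Q` may be a symbol of the given vocabulary, which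
the other half must not minimize.

Without `flag`, the disjunctive heads of `P` are eliminated by deriving disjunctions. A finite set
`D` of ground atoms, read as a disjunction, is derivable if some ground rule of the reduct has its
head inside `D` and `D ∪ {c}` is derivable for each intensional atom `c` of its positive body. A
model of `P` is stable iff every true atom `c₀` has a derivable `D ∪ {c₀}` with all atoms of `D`
false. Soundness: every submodel of the reduct meets each derivable set, and it cannot meet false
atoms. Completeness: if `c₀` has no such derivation, Zorn's lemma extends the false atoms together
with `c₀` to a maximal set `Z` with no derivable finite subset, and the true atoms outside `Z` form
a smaller model of the reduct.

An infinite domain has as many elements as there are finite sets of ground atoms, so elements can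
code these sets: `mem` is membership, `ins p (d, d', x)` says that the set of `d'` is contained in
that of `d` with `p(x)` added, and `emp` marks codes of sets of false atoms. Derivability (`der`,
`dins`, `ok`) is then a least fixed point given by normal rules. Soundness needs no assumption on
the domain, so only completeness uses infinity. The halves are `CombVal.Stable.finite`,
`CombVal.Stable.right_stable`, `CombVal.Stable.left_stable` and `exists_stable_of_finite`,
`exists_stable_of_infinite`. -/

namespace LogicProgram

/-! ### Stable models as minimal models of the reduct, and names for intensional predicates -/

section General

variable {L : FirstOrder.Language.{u, v}} {M : Type w}

/-- A stable model is a model of the program that has no proper submodel of the reduct. -/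
theorem Program.stableModel_iff [L.Structure M] (P : Program L) : P.StableModel M ↔
    (∀ r ∈ P, r.Holds (structInterp L M) (structInterp L M)) ∧
    ∀ X : PredInterp L M, (∀ n R x, X n R x → structInterp L M n R x) →
      (∀ n R, ¬ P.Intensional R → ∀ x, structInterp L M n R x → X n R x) →
      (∀ r ∈ P, r.Holds X (structInterp L M)) → ∀ n R x, structInterp L M n R x → X n R x := by
  refine and_congr_right fun _ => ⟨fun h X hle hext hX => ?_, fun h X hX hr => ?_⟩
  · have hs : P.starInterp X = X := by
      funext n R x
      by_cases hR : P.Intensional R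
      · simp [Program.starInterp, hR]
      · simpa [Program.starInterp, hR] using ⟨hext n R hR x, hle n R x⟩
    intro n R x hx
    by_contra hn
    refine h X ⟨fun n R _ => hle n R, fun hge => ?_⟩ (by rwa [hs])
    by_cases hR : P.Intensional R
    · exact hn (hge n R hR x hx)
    · exact hn (hext n R hR x hx)
  · refine hX.2 fun n R hR x hx => ?_
    -- `X` is arbitrary on extensional predicates; `P.starInterp X` corrects it there.
    have := h (P.starInterp X) ?_ ?_ hr n R x hx
    · simpa [Program.starInterp, hR] using this
    · rintro n R x (⟨hR, hx⟩ | ⟨-, hx⟩)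
      · exact hX.1 n R hR x hx
      · exact hx
    · intro n R hR x hx
      exact Or.inr ⟨hR, hx⟩

theorem Literal.holds_of_imp [L.Structure M] {I I' J : PredInterp L M} {s : ℕ → M}
    {l : Literal L} (h : l.Holds I J s)
    (hI : ∀ c, l = .pos (.pred c) → c.Holds I s → c.Holds I' s) : l.Holds I' J s := by
  rcases l with (c | ⟨t, t'⟩) | c
  · exact hI c rfl h
  · exact h
  · exact h

/-- An enumeration, by small types, of the intensional predicates of a program. -/
structure Naming (P : Program L) where
  T : ℕ → Type
  finite : Finite (Σ n, T n)
  equiv : ∀ n, T n ≃ {R : L.Relations n // P.Intensional R}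

theorem Program.finite_intensional {P : Program L} (hP : P.Finite) :
    {p : Σ n, L.Relations n | P.Intensional p.2}.Finite := by
  refine Set.Finite.subset (hP.biUnion fun r _ =>
    (List.finite_toSet (r.head.map fun a => (⟨a.arity, a.pred⟩ : Σ n, L.Relations n)))) ?_
  rintro ⟨n, R⟩ ⟨r, hr, args, ha⟩
  simp only [Set.mem_iUnion, Set.mem_ofPred_eq, List.mem_map]
  exact ⟨r, hr, _, ha, rfl⟩

/-- Auxiliary predicates must live in universe zero while those of `L` need not; being finite in
number, the intensional ones can be shrunk. -/
theorem exists_naming {P : Program L} (hP : P.Finite) : Nonempty (Naming P) := by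
  have hf : Finite {p : Σ n, L.Relations n // P.Intensional p.2} := P.finite_intensional hP
  have hn : ∀ n, Finite {R : L.Relations n // P.Intensional R} := fun n =>
    Finite.of_injective (β := {p : Σ n, L.Relations n // P.Intensional p.2})
      (fun R => ⟨⟨n, R.1⟩, R.2⟩) (fun R R' h => by simpa [Subtype.ext_iff] using h)
  refine ⟨⟨fun n => Shrink.{0} {R : L.Relations n // P.Intensional R}, ?_,
    fun n => (equivShrink _).symm⟩⟩
  refine Finite.of_injective (β := {p : Σ n, L.Relations n // P.Intensional p.2})
    (fun p => ⟨⟨p.1, ((equivShrink _).symm p.2).1⟩, ((equivShrink _).symm p.2).2⟩) ?_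
  rintro ⟨n, p⟩ ⟨m, q⟩ h
  simp only [Subtype.mk.injEq, Sigma.mk.injEq] at h
  obtain ⟨rfl, h⟩ := h
  have h2 := (equivShrink _).symm.injective (Subtype.ext (eq_of_heq h))
  rw [h2]

open Classical in
/-- Read the intensional predicates of a program in `Z` and the others in `Y`. -/
def Naming.override {P : Program L} (a : Naming P) (Z : ∀ n, a.T n → (Fin n → M) → Prop)
    (Y : PredInterp L M) : PredInterp L M := fun n R x =>
  if h : P.Intensional R then Z n ((a.equiv n).symm ⟨R, h⟩) x else Y n R x

/-- The predicate with a given name. -/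
def Naming.pred {P : Program L} (a : Naming P) {n : ℕ} (t : a.T n) : L.Relations n :=
  (a.equiv n t).1

theorem Naming.intensional_pred {P : Program L} (a : Naming P) {n : ℕ} (t : a.T n) :
    P.Intensional (a.pred t) :=
  (a.equiv n t).2

theorem Naming.exists_pred {P : Program L} (a : Naming P) {n : ℕ} {R : L.Relations n}
    (h : P.Intensional R) : ∃ t : a.T n, a.pred t = R :=
  ⟨(a.equiv n).symm ⟨R, h⟩, by simp [Naming.pred]⟩

theorem Naming.override_pred {P : Program L} (a : Naming P)
    (Z : ∀ n, a.T n → (Fin n → M) → Prop) (Y : PredInterp L M) {n : ℕ} (t : a.T n)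
    (x : Fin n → M) : a.override Z Y n (a.pred t) x ↔ Z n t x := by
  have h := a.intensional_pred t
  have : (a.equiv n).symm ⟨a.pred t, h⟩ = t := by
    rw [Equiv.symm_apply_eq]; rfl
  simp [Naming.override, h, this]

theorem Naming.override_of_not {P : Program L} (a : Naming P)
    (Z : ∀ n, a.T n → (Fin n → M) → Prop) (Y : PredInterp L M) {n : ℕ} {R : L.Relations n}
    (h : ¬ P.Intensional R) (x : Fin n → M) : a.override Z Y n R x ↔ Y n R x := by
  simp [Naming.override, h]

theorem Program.intensional_of_mem_head {P : Program L} {r : Rule L} (hr : r ∈ P)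
    {a : PredAtom L} (ha : a ∈ r.head) : P.Intensional a.pred :=
  ⟨r, hr, a.args, ha⟩

end General

/-! ### Translating literals between relational expansions -/

section Lift

variable {L : FirstOrder.Language.{u, v}} {A C : FirstOrder.Language.{0, 0}} [A.IsRelational]

/-- Change the relational expansion a term is written in, and shift its variables by one. -/
def liftTerm : (L.sum A).Term ℕ → (L.sum C).Term ℕ
  | .var n => .var (n + 1)
  | .func (Sum.inl f) ts => .func (Sum.inl f) fun i => liftTerm (ts i)
  | .func (Sum.inr f) _ => isEmptyElim f

/-- Translate the atoms of a literal. -/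
def Literal.lift (F G : PredAtom (L.sum A) → PredAtom (L.sum C)) :
    Literal (L.sum A) → Literal (L.sum C)
  | .pos (.pred a) => .pos (.pred (F a))
  | .pos (.eq t₁ t₂) => .pos (.eq (liftTerm t₁) (liftTerm t₂))
  | .neg (.pred a) => .neg (.pred (G a))
  | .neg (.eq t₁ t₂) => .neg (.eq (liftTerm t₁) (liftTerm t₂))

variable {M : Type w} [L.Structure M] [A.Structure M] [C.Structure M]

/-- The shift frees variable `0`, which in the translated rules of `P` ranges over codes of finite
sets. -/
theorem realize_liftTerm (t : (L.sum A).Term ℕ) (s : ℕ → M) :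
    (liftTerm t : (L.sum C).Term ℕ).realize s = t.realize fun n => s (n + 1) := by
  induction t with
  | var n => rfl
  | func f ts ih =>
    rcases f with f | f
    · simp only [liftTerm, FirstOrder.Language.Term.realize, ih]
      rfl
    · exact isEmptyElim f

theorem Literal.holds_lift {F G : PredAtom (L.sum A) → PredAtom (L.sum C)}
    {I J : PredInterp (L.sum C) M} {I' J' : PredInterp (L.sum A) M} {s : ℕ → M}
    (hF : ∀ a, (F a).Holds I s ↔ a.Holds I' fun n => s (n + 1))
    (hG : ∀ a, (G a).Holds J s ↔ a.Holds J' fun n => s (n + 1)) (l : Literal (L.sum A)) :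
    (l.lift F G).Holds I J s ↔ l.Holds I' J' fun n => s (n + 1) := by
  rcases l with (a | ⟨t₁, t₂⟩) | (a | ⟨t₁, t₂⟩)
  · exact hF a
  · simp [Literal.lift, Literal.Holds, Atom.Holds, realize_liftTerm]
  · exact not_congr (hG a)
  · simp [Literal.lift, Literal.Holds, Atom.Holds, realize_liftTerm]

end Lift

end LogicProgram

/-! ### Syntax of the combined normal program -/

namespace LogicProgram

/-- The auxiliary predicates of the combined program. The predicates of `A` and `B`, `mem`, `ins`,
`emp`, `flag` and `next` are guessed, the others are intensional. -/
inductive CombRel (A B : FirstOrder.Language.{0, 0}) (S T : ℕ → Type) : ℕ → Type where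
  | left {n : ℕ} (R : A.Relations n) : CombRel A B S T n
  | right {n : ℕ} (R : B.Relations n) : CombRel A B S T n
  | mem {n : ℕ} (p : S n) : CombRel A B S T (n + 1)
  | ins {n : ℕ} (p : S n) : CombRel A B S T (n + 2)
  | emp : CombRel A B S T 1
  | flag : CombRel A B S T 0
  | next : CombRel A B S T 2
  | star {n : ℕ} (t : T n) : CombRel A B S T n
  | reach : CombRel A B S T 2
  | der : CombRel A B S T 1
  | dins {n : ℕ} (p : S n) : CombRel A B S T (n + 1)
  | ok {n : ℕ} (p : S n) : CombRel A B S T n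

/-- The intensional predicates of the combined program. -/
def CombRel.IsHead {A B : FirstOrder.Language.{0, 0}} {S T : ℕ → Type} :
    ∀ {n : ℕ}, CombRel A B S T n → Prop
  | _, .star _ => True
  | _, .reach => True
  | _, .der => True
  | _, .dins _ => True
  | _, .ok _ => True
  | _, _ => False

/-- The relational language of the auxiliary predicates of the combined program. -/
def combLang (A B : FirstOrder.Language.{0, 0}) (S T : ℕ → Type) : FirstOrder.Language.{0, 0} :=
  ⟨fun _ => Empty, CombRel A B S T⟩

instance (A B : FirstOrder.Language.{0, 0}) (S T : ℕ → Type) : (combLang A B S T).IsRelational :=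
  fun _ => inferInstanceAs (IsEmpty Empty)

theorem finite_combRel {A B : FirstOrder.Language.{0, 0}} {S T : ℕ → Type}
    [Finite (Σ n, A.Relations n)] [Finite (Σ n, B.Relations n)] [Finite (Σ n, S n)]
    [Finite (Σ n, T n)] : Finite (Σ n, CombRel A B S T n) := by
  let f : (Σ n, A.Relations n) ⊕ (Σ n, B.Relations n) ⊕ (Σ n, T n) ⊕ ((Σ n, S n) × Fin 4) ⊕ Fin 5 →
      Σ n, CombRel A B S T n
    | .inl R => ⟨_, .left R.2⟩
    | .inr (.inl R) => ⟨_, .right R.2⟩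
    | .inr (.inr (.inl t)) => ⟨_, .star t.2⟩
    | .inr (.inr (.inr (.inl (p, 0)))) => ⟨_, .mem p.2⟩
    | .inr (.inr (.inr (.inl (p, 1)))) => ⟨_, .ins p.2⟩
    | .inr (.inr (.inr (.inl (p, 2)))) => ⟨_, .dins p.2⟩
    | .inr (.inr (.inr (.inl (p, 3)))) => ⟨_, .ok p.2⟩
    | .inr (.inr (.inr (.inr 0))) => ⟨_, .emp⟩
    | .inr (.inr (.inr (.inr 1))) => ⟨_, .flag⟩
    | .inr (.inr (.inr (.inr 2))) => ⟨_, .next⟩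
    | .inr (.inr (.inr (.inr 3))) => ⟨_, .reach⟩
    | .inr (.inr (.inr (.inr 4))) => ⟨_, .der⟩
  refine Finite.of_surjective f ?_
  rintro ⟨_, c⟩
  cases c with
  | left R => exact ⟨.inl ⟨_, R⟩, rfl⟩
  | right R => exact ⟨.inr (.inl ⟨_, R⟩), rfl⟩
  | star t => exact ⟨.inr (.inr (.inl ⟨_, t⟩)), rfl⟩
  | mem p => exact ⟨.inr (.inr (.inr (.inl (⟨_, p⟩, 0)))), rfl⟩
  | ins p => exact ⟨.inr (.inr (.inr (.inl (⟨_, p⟩, 1)))), rfl⟩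
  | dins p => exact ⟨.inr (.inr (.inr (.inl (⟨_, p⟩, 2)))), rfl⟩
  | ok p => exact ⟨.inr (.inr (.inr (.inl (⟨_, p⟩, 3)))), rfl⟩
  | emp => exact ⟨.inr (.inr (.inr (.inr 0))), rfl⟩
  | flag => exact ⟨.inr (.inr (.inr (.inr 1))), rfl⟩
  | next => exact ⟨.inr (.inr (.inr (.inr 2))), rfl⟩
  | reach => exact ⟨.inr (.inr (.inr (.inr 3))), rfl⟩
  | der => exact ⟨.inr (.inr (.inr (.inr 4))), rfl⟩

section Combination

variable {L : FirstOrder.Language.{u, v}} {A B : FirstOrder.Language.{0, 0}}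
  [A.IsRelational] [B.IsRelational]
  {P : Program (L.sum A)} {Q : Program (L.sum B)} (a : Naming P) (b : Naming Q)

/-- The vocabulary of the combined program of `P` and `Q`. -/
abbrev combVoc : FirstOrder.Language.{u, v} := L.sum (combLang A B a.T b.T)

/-- The atom of an auxiliary predicate. -/
def relAtom {n : ℕ} (R : CombRel A B a.T b.T n) (ts : Fin n → (combVoc a b).Term ℕ) :
    PredAtom (combVoc a b) :=
  ⟨n, Sum.inr R, ts⟩

/-- A predicate of `P` as a predicate of the combined program. -/
def leftRel {n : ℕ} : (L.sum A).Relations n → (combVoc a b).Relations n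
  | Sum.inl R => Sum.inl R
  | Sum.inr R => Sum.inr (CombRel.left R)

/-- A predicate of `Q` as a predicate of the combined program. -/
def rightRel {n : ℕ} : (L.sum B).Relations n → (combVoc a b).Relations n
  | Sum.inl R => Sum.inl R
  | Sum.inr R => Sum.inr (CombRel.right R)

/-- An atom of `P` as an atom of the combined program. -/
def leftAtom (c : PredAtom (L.sum A)) : PredAtom (combVoc a b) :=
  ⟨c.arity, leftRel a b c.pred, fun i => liftTerm (c.args i)⟩

/-- An atom of `Q` as an atom of the combined program. -/
def rightAtom (c : PredAtom (L.sum B)) : PredAtom (combVoc a b) :=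
  ⟨c.arity, rightRel a b c.pred, fun i => liftTerm (c.args i)⟩

open Classical in
/-- Replace the intensional predicates of `Q` by their copies. -/
noncomputable def starAtom (c : PredAtom (L.sum B)) : PredAtom (combVoc a b) :=
  if h : Q.Intensional c.pred then
    relAtom a b (.star ((b.equiv _).symm ⟨c.pred, h⟩)) fun i => liftTerm (c.args i)
  else rightAtom a b c

open Classical in
/-- Replace an atom `p(x)` with `p` intensional in `P` by `f p (v₀, x)`. -/
noncomputable def tagAtom (f : ∀ n, a.T n → CombRel A B a.T b.T (n + 1)) (c : PredAtom (L.sum A)) :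
    PredAtom (combVoc a b) :=
  if h : P.Intensional c.pred then
    relAtom a b (f _ ((a.equiv _).symm ⟨c.pred, h⟩))
      (Fin.cons (.var 0) fun i => liftTerm (c.args i))
  else leftAtom a b c

/-- The body literal `flag`. -/
def flagLit : Literal (combVoc a b) := .pos (.pred (relAtom a b .flag Fin.elim0))

/-- The body literal `¬ flag`. -/
def noFlagLit : Literal (combVoc a b) := .neg (.pred (relAtom a b .flag Fin.elim0))

variable {a b} in
/-- A rule with at least one body literal. -/
def mkRule (l : Literal (combVoc a b)) (ls : List (Literal (combVoc a b)))
    (hs : List (PredAtom (combVoc a b))) : Rule (combVoc a b) :=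
  ⟨l :: ls, hs, by simp⟩

variable {a b} in
/-- Individual variables arranged in rows. -/
def rowVar (i j : ℕ) : (combVoc a b).Term ℕ := .var (Nat.pair i j)

variable {a b} in
/-- A tuple of variables of a given row. -/
def row (n i : ℕ) : Fin n → (combVoc a b).Term ℕ := fun j => rowVar i j

/-- The rules that are added in order that `R` be intensional. -/
def loopRule {n : ℕ} (R : CombRel A B a.T b.T n) : Rule (combVoc a b) :=
  mkRule (.pos (.pred (relAtom a b R (row n 0)))) [] [relAtom a b R (row n 0)]

/-- The positive body literal `R(ts)`. -/
def posLit {n : ℕ} (R : CombRel A B a.T b.T n) (ts : Fin n → (combVoc a b).Term ℕ) :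
    Literal (combVoc a b) :=
  .pos (.pred (relAtom a b R ts))

/-- The negative body literal `¬ R(ts)`. -/
def negLit {n : ℕ} (R : CombRel A B a.T b.T n) (ts : Fin n → (combVoc a b).Term ℕ) :
    Literal (combVoc a b) :=
  .neg (.pred (relAtom a b R ts))

/-- The atom `p(x₀,…)` for an intensional predicate of `P`. -/
def leftRow {n : ℕ} (p : a.T n) : PredAtom (combVoc a b) := ⟨n, leftRel a b (a.pred p), row n 0⟩

/-- The atom `q(x₀,…)` for an intensional predicate of `Q`. -/
def rightRow {n : ℕ} (q : b.T n) : PredAtom (combVoc a b) := ⟨n, rightRel a b (b.pred q), row n 0⟩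

/-- A rule of `Q` with its intensional predicates replaced by their copies. -/
noncomputable def starRule (r : Rule (L.sum B)) : Rule (combVoc a b) :=
  mkRule (flagLit a b) (r.body.map (Literal.lift (starAtom a b) (rightAtom a b)))
    (r.head.map (starAtom a b))

/-- The constraint that a rule of `P` is true. -/
def modelRule (r : Rule (L.sum A)) : Rule (combVoc a b) :=
  mkRule (noFlagLit a b) (r.body.map (Literal.lift (leftAtom a b) (leftAtom a b)) ++
    r.head.map (fun c => .neg (.pred (leftAtom a b c)))) []

/-- The inference rule for `der` given by a rule of `P`. -/
noncomputable def derRule (r : Rule (L.sum A)) : Rule (combVoc a b) :=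
  mkRule (noFlagLit a b)
    (r.body.map (Literal.lift (tagAtom a b fun _ p => .dins p) (leftAtom a b)) ++
      r.head.map (fun c => .pos (.pred (tagAtom a b (fun _ p => .mem p) c))))
    [relAtom a b .der ![.var 0]]

/-- `next` is functional, `reach` is its transitive closure, and `reach` is total. -/
def finiteRules : Set (Rule (combVoc a b)) :=
  {mkRule (flagLit a b) [posLit a b .next ![rowVar 0 0, rowVar 0 1],
      posLit a b .next ![rowVar 0 0, rowVar 0 2], .neg (.eq (rowVar 0 1) (rowVar 0 2))] [],
    mkRule (flagLit a b) [posLit a b .next ![rowVar 0 0, rowVar 0 1]]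
      [relAtom a b .reach ![rowVar 0 0, rowVar 0 1]],
    mkRule (flagLit a b) [posLit a b .reach ![rowVar 0 0, rowVar 0 1],
      posLit a b .next ![rowVar 0 1, rowVar 0 2]] [relAtom a b .reach ![rowVar 0 0, rowVar 0 2]],
    mkRule (flagLit a b) [negLit a b .reach ![rowVar 0 0, rowVar 0 1]] []}

/-- The two inclusions between an intensional predicate of `Q` and its copy. -/
def copyRules {n : ℕ} (q : b.T n) : Set (Rule (combVoc a b)) :=
  {mkRule (flagLit a b) [posLit a b (.star q) (row n 0), .neg (.pred (rightRow a b q))] [],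
    mkRule (flagLit a b) [.pos (.pred (rightRow a b q)), negLit a b (.star q) (row n 0)] []}

/-- The body expressing that an atom `q(y)` of `d'` is not in `d`, where `ins p (d, d', x)`. -/
def insBody {n m : ℕ} (p : a.T n) (q : a.T m) : List (Literal (combVoc a b)) :=
  [posLit a b (.ins p) (Fin.cons (rowVar 2 0) (Fin.cons (rowVar 2 1) (row n 0))),
    posLit a b (.mem q) (Fin.cons (rowVar 2 1) (row m 1)),
    negLit a b (.mem q) (Fin.cons (rowVar 2 0) (row m 1))]

/-- `emp` holds of codes of sets of false atoms only. -/
def empRule {n : ℕ} (p : a.T n) : Rule (combVoc a b) :=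
  mkRule (noFlagLit a b) [posLit a b .emp ![rowVar 2 0],
    posLit a b (.mem p) (Fin.cons (rowVar 2 0) (row n 0)), .pos (.pred (leftRow a b p))] []

/-- Derivability of `d ∪ {p(x)}`. -/
def dinsRule {n : ℕ} (p : a.T n) : Rule (combVoc a b) :=
  mkRule (noFlagLit a b)
    [posLit a b (.ins p) (Fin.cons (rowVar 2 0) (Fin.cons (rowVar 2 1) (row n 0))),
      posLit a b .der ![rowVar 2 1]]
    [relAtom a b (.dins p) (Fin.cons (rowVar 2 0) (row n 0))]

/-- Derivability of `p(x)`. -/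
def okRule {n : ℕ} (p : a.T n) : Rule (combVoc a b) :=
  mkRule (noFlagLit a b)
    [posLit a b .emp ![rowVar 2 0], posLit a b (.dins p) (Fin.cons (rowVar 2 0) (row n 0))]
    [relAtom a b (.ok p) (row n 0)]

/-- Each true atom is derivable. -/
def supportRule {n : ℕ} (p : a.T n) : Rule (combVoc a b) :=
  mkRule (noFlagLit a b) [.pos (.pred (leftRow a b p)), negLit a b (.ok p) (row n 0)] []

/-- The combined program: with `flag`, it says that the structure is finite and that `Q` holds;
without `flag`, that each atom is derivable from `P` by finitely many inferences. -/
inductive combProg : Rule (combVoc a b) → Prop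
  | loop {n : ℕ} {R : CombRel A B a.T b.T n} (h : R.IsHead) : combProg (loopRule a b R)
  | star {r : Rule (L.sum B)} (h : r ∈ Q) : combProg (starRule a b r)
  | model {r : Rule (L.sum A)} (h : r ∈ P) : combProg (modelRule a b r)
  | der {r : Rule (L.sum A)} (h : r ∈ P) : combProg (derRule a b r)
  | finite {r : Rule (combVoc a b)} (h : r ∈ finiteRules a b) : combProg r
  | copy {n : ℕ} {q : b.T n} {r : Rule (combVoc a b)} (h : r ∈ copyRules a b q) : combProg r
  | insNe {n m : ℕ} {p : a.T n} {q : a.T m}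
      (h : (⟨n, p⟩ : Σ n, a.T n) ≠ ⟨m, q⟩) : combProg (mkRule (noFlagLit a b) (insBody a b p q) [])
  | insEq {n : ℕ} {p : a.T n} (i : Fin n) : combProg (mkRule (noFlagLit a b)
      (.neg (.eq (rowVar 0 i) (rowVar 1 i)) :: insBody a b p p) [])
  | emp {n : ℕ} {p : a.T n} : combProg (empRule a b p)
  | dins {n : ℕ} {p : a.T n} : combProg (dinsRule a b p)
  | ok {n : ℕ} {p : a.T n} : combProg (okRule a b p)
  | support {n : ℕ} {p : a.T n} : combProg (supportRule a b p)

/-- The combined program as a set of rules. -/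
def combProgram : Program (combVoc a b) := {r | combProg a b r}

omit [A.IsRelational] [B.IsRelational] in
theorem finite_finiteRules : (finiteRules a b).Finite := by
  simp [finiteRules]

omit [A.IsRelational] [B.IsRelational] in
theorem finite_copyRules {n : ℕ} (q : b.T n) : (copyRules a b q).Finite := by
  simp [copyRules]

theorem finite_combProgram [Finite (Σ n, A.Relations n)] [Finite (Σ n, B.Relations n)]
    (hP : P.Finite) (hQ : Q.Finite) : (combProgram a b).Finite := by
  have := a.finite
  have := b.finite
  have := finite_combRel (A := A) (B := B) (S := a.T) (T := b.T)
  have hi : (Set.range fun x : (Σ p : (Σ n, a.T n), Fin p.1) => mkRule (noFlagLit a b)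
      (.neg (.eq (rowVar 0 x.2) (rowVar 1 x.2)) :: insBody a b x.1.2 x.1.2) []).Finite :=
    Set.finite_range _
  refine Set.Finite.subset
    ((Set.finite_range fun x : Σ n, CombRel A B a.T b.T n => loopRule a b x.2).union <|
    (hQ.image (starRule a b)).union <|
    (hP.image (modelRule a b)).union <|
    (hP.image (derRule a b)).union <|
    (finite_finiteRules a b).union <|
    (Set.finite_iUnion fun x : Σ n, b.T n => finite_copyRules a b x.2).union <|
    (Set.finite_range fun x : (Σ n, a.T n) × (Σ n, a.T n) =>
      mkRule (noFlagLit a b) (insBody a b x.1.2 x.2.2) []).union <| hi.union <|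
    (Set.finite_range fun x : Σ n, a.T n => empRule a b x.2).union <|
    (Set.finite_range fun x : Σ n, a.T n => dinsRule a b x.2).union <|
    (Set.finite_range fun x : Σ n, a.T n => okRule a b x.2).union <|
    (Set.finite_range fun x : Σ n, a.T n => supportRule a b x.2)) ?_
  intro r hr
  cases hr with
  | @loop n R h => exact Or.inl ⟨⟨n, R⟩, rfl⟩
  | @star r h => exact Or.inr <| Or.inl ⟨r, h, rfl⟩
  | @model r h => exact Or.inr <| Or.inr <| Or.inl ⟨r, h, rfl⟩
  | @der r h => exact Or.inr <| Or.inr <| Or.inr <| Or.inl ⟨r, h, rfl⟩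
  | finite h => exact Or.inr <| Or.inr <| Or.inr <| Or.inr <| Or.inl h
  | @copy n q _ h =>
    exact Or.inr <| Or.inr <| Or.inr <| Or.inr <| Or.inr <| Or.inl <|
      Set.mem_iUnion.2 ⟨⟨n, q⟩, h⟩
  | @insNe n m p q h =>
    exact Or.inr <| Or.inr <| Or.inr <| Or.inr <| Or.inr <| Or.inr <| Or.inl
      ⟨(⟨n, p⟩, ⟨m, q⟩), rfl⟩
  | @insEq n p i =>
    exact Or.inr <| Or.inr <| Or.inr <| Or.inr <| Or.inr <| Or.inr <| Or.inr <| Or.inl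
      ⟨⟨⟨n, p⟩, i⟩, rfl⟩
  | @emp n p =>
    exact Or.inr <| Or.inr <| Or.inr <| Or.inr <| Or.inr <| Or.inr <| Or.inr <| Or.inr <| Or.inl
      ⟨⟨n, p⟩, rfl⟩
  | @dins n p =>
    exact Or.inr <| Or.inr <| Or.inr <| Or.inr <| Or.inr <| Or.inr <| Or.inr <| Or.inr <| Or.inr <|
      Or.inl ⟨⟨n, p⟩, rfl⟩
  | @ok n p =>
    exact Or.inr <| Or.inr <| Or.inr <| Or.inr <| Or.inr <| Or.inr <| Or.inr <| Or.inr <| Or.inr <|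
      Or.inr <| Or.inl ⟨⟨n, p⟩, rfl⟩
  | @support n p =>
    exact Or.inr <| Or.inr <| Or.inr <| Or.inr <| Or.inr <| Or.inr <| Or.inr <| Or.inr <| Or.inr <|
      Or.inr <| Or.inr ⟨⟨n, p⟩, rfl⟩

/-- The only heads inherited from a given program are those of `Q`; the heads of `P` have moved into
bodies. -/
theorem isNormal_combProgram (hQ : Q.IsNormal) : (combProgram a b).IsNormal := by
  intro r hr
  cases hr with
  | star h => simpa [starRule, mkRule] using hQ _ h
  | finite h => rcases h with rfl | rfl | rfl | rfl <;> simp [mkRule]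
  | copy h => rcases h with rfl | rfl <;> simp [mkRule]
  | _ => simp [mkRule, loopRule, modelRule, derRule, empRule, dinsRule, okRule, supportRule]

/-- The tautological loop rules make the list of intensional predicates independent of which rules
`P` and `Q` contain. -/
theorem intensional_combProgram {n : ℕ} (R : (combVoc a b).Relations n) :
    (combProgram a b).Intensional R ↔ ∃ c : CombRel A B a.T b.T n, c.IsHead ∧ R = Sum.inr c := by
  constructor
  · rintro ⟨r, hr, ts, h⟩
    have key : ∀ {m : ℕ} (c : CombRel A B a.T b.T m) (us : Fin m → (combVoc a b).Term ℕ),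
        c.IsHead → (⟨n, R, ts⟩ : PredAtom (combVoc a b)) = relAtom a b c us →
        ∃ c : CombRel A B a.T b.T n, c.IsHead ∧ R = Sum.inr c := by
      intro m c us hc he
      obtain ⟨rfl, h2⟩ := PredAtom.mk.inj he
      exact ⟨c, hc, eq_of_heq h2.1⟩
    cases hr with
    | loop hc => exact key _ _ hc (by simpa [loopRule, mkRule] using h)
    | star hq =>
      obtain ⟨c, hc, he⟩ := List.mem_map.1 h
      rw [starAtom, dif_pos (Program.intensional_of_mem_head hq hc)] at he
      exact key _ _ (by trivial) he.symm
    | model _ => simp [modelRule, mkRule] at h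
    | der _ => exact key (.der) _ True.intro (by simpa [derRule, mkRule] using h)
    | finite hf =>
      rcases hf with rfl | rfl | rfl | rfl
      · simp [mkRule] at h
      · exact key (.reach) _ True.intro (by simpa [mkRule] using h)
      · exact key (.reach) _ True.intro (by simpa [mkRule] using h)
      · simp [mkRule] at h
    | copy hf => rcases hf with rfl | rfl <;> simp [mkRule] at h
    | insNe _ => simp [mkRule] at h
    | insEq _ => simp [mkRule] at h
    | emp => simp [empRule, mkRule] at h
    | dins => exact key (.dins _) _ (by trivial) (List.mem_singleton.1 h)
    | ok => exact key (.ok _) _ (by trivial) (List.mem_singleton.1 h)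
    | support => simp [supportRule, mkRule] at h
  · rintro ⟨c, hc, rfl⟩
    exact ⟨_, .loop hc, row n 0, List.mem_singleton.2 rfl⟩

end Combination

end LogicProgram

/-! ### Interpretations of the auxiliary predicates -/

namespace LogicProgram

section Valuation

variable {L : FirstOrder.Language.{u, v}} {A B : FirstOrder.Language.{0, 0}}
  {P : Program (L.sum A)} {Q : Program (L.sum B)} (a : Naming P) (b : Naming Q)

/-- An interpretation of the auxiliary predicates. -/
abbrev CombVal (M : Type w) := ∀ n : ℕ, CombRel A B a.T b.T n → (Fin n → M) → Prop

variable {a b} {M : Type w} [L.Structure M]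

/-- The interpretation of all predicates of the combined program. -/
def CombVal.interp (W : CombVal a b M) : PredInterp (combVoc a b) M := fun n R x =>
  match R with
  | Sum.inl R => structInterp L M n R x
  | Sum.inr R => W n R x

/-- The induced interpretation of the predicates of `P`. -/
def CombVal.left (W : CombVal a b M) : PredInterp (L.sum A) M := fun n R x =>
  W.interp n (leftRel a b R) x

/-- The induced interpretation of the predicates of `Q`. -/
def CombVal.right (W : CombVal a b M) : PredInterp (L.sum B) M := fun n R x =>
  W.interp n (rightRel a b R) x

/-- The induced interpretation of the predicates of `Q`, the intensional ones being replaced by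
their copies. -/
def CombVal.starred (W : CombVal a b M) : PredInterp (L.sum B) M :=
  b.override (fun n t x => W n (.star t) x) W.right

/-- The interpretation of the predicates of `P` where an intensional `p(x)` is read as
`f p (d, x)`. -/
def CombVal.tagged (W : CombVal a b M) (f : ∀ n, a.T n → CombRel A B a.T b.T (n + 1)) (d : M) :
    PredInterp (L.sum A) M :=
  a.override (fun n p x => W (n + 1) (f n p) (Fin.cons d x)) W.left

/-- The truth of the rules of the combined program when positive occurrences are read in `W` and
negative ones in `V`. -/
structure CombVal.Sem [A.Structure M] [B.Structure M] (W V : CombVal a b M) : Prop where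
  star : W 0 .flag Fin.elim0 → ∀ r ∈ Q, r.Holds W.starred V.right
  star_le : W 0 .flag Fin.elim0 → ∀ (n) (q : b.T n) (x : Fin n → M), W n (.star q) x →
    V.right n (b.pred q) x
  le_star : W 0 .flag Fin.elim0 → ∀ (n) (q : b.T n) (x : Fin n → M), W.right n (b.pred q) x →
    V n (.star q) x
  next_unique : W 0 .flag Fin.elim0 → ∀ x y z, W 2 .next ![x, y] → W 2 .next ![x, z] → y = z
  reach_base : W 0 .flag Fin.elim0 → ∀ x y, W 2 .next ![x, y] → W 2 .reach ![x, y]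
  reach_step : W 0 .flag Fin.elim0 → ∀ x y z, W 2 .reach ![x, y] → W 2 .next ![y, z] →
    W 2 .reach ![x, z]
  reach_all : W 0 .flag Fin.elim0 → ∀ x y, V 2 .reach ![x, y]
  model : ¬ V 0 .flag Fin.elim0 → ∀ r ∈ P, ∀ s : ℕ → M, (∀ l ∈ r.body, l.Holds W.left V.left s) →
    ∃ c ∈ r.head, c.Holds V.left s
  ins : ¬ V 0 .flag Fin.elim0 → ∀ (n) (p : a.T n) (m) (q : a.T m) (d d' : M) (x : Fin n → M)
    (y : Fin m → M), W _ (.ins p) (Fin.cons d (Fin.cons d' x)) → W _ (.mem q) (Fin.cons d' y) →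
    ¬ V _ (.mem q) (Fin.cons d y) →
    (⟨n, p, x⟩ : Σ n, a.T n × (Fin n → M)) = ⟨m, q, y⟩
  emp : ¬ V 0 .flag Fin.elim0 → ∀ (n) (p : a.T n) (e : M) (x : Fin n → M), W 1 .emp ![e] →
    W _ (.mem p) (Fin.cons e x) → ¬ W.left n (a.pred p) x
  dins : ¬ V 0 .flag Fin.elim0 → ∀ (n) (p : a.T n) (d d' : M) (x : Fin n → M),
    W _ (.ins p) (Fin.cons d (Fin.cons d' x)) → W 1 .der ![d'] → W _ (.dins p) (Fin.cons d x)
  der : ¬ V 0 .flag Fin.elim0 → ∀ r ∈ P, ∀ (s : ℕ → M) (d : M),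
    (∀ l ∈ r.body, l.Holds (W.tagged (fun _ p => .dins p) d) V.left s) →
    (∀ c ∈ r.head, c.Holds (W.tagged (fun _ p => .mem p) d) s) → W 1 .der ![d]
  ok : ¬ V 0 .flag Fin.elim0 → ∀ (n) (p : a.T n) (e : M) (x : Fin n → M), W 1 .emp ![e] →
    W _ (.dins p) (Fin.cons e x) → W _ (.ok p) x
  support : ¬ V 0 .flag Fin.elim0 → ∀ (n) (p : a.T n) (x : Fin n → M), W.left n (a.pred p) x →
    V _ (.ok p) x

section

variable [(combLang A B a.T b.T).Structure M] {W : CombVal a b M}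

theorem realize_nil (s : ℕ → M) : (fun i : Fin 0 =>
    (Fin.elim0 i : (combVoc a b).Term ℕ).realize s) = Fin.elim0 :=
  Subsingleton.elim _ _

theorem realize_one (s : ℕ → M) (t : (combVoc a b).Term ℕ) :
    (fun i : Fin 1 => (![t] i).realize s) = ![t.realize s] := by
  funext i; fin_cases i; rfl

theorem realize_two (s : ℕ → M) (t t' : (combVoc a b).Term ℕ) :
    (fun i : Fin 2 => (![t, t'] i).realize s) = ![t.realize s, t'.realize s] := by
  funext i; fin_cases i <;> rfl

theorem realize_cons {n : ℕ} (s : ℕ → M) (t : (combVoc a b).Term ℕ)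
    (ts : Fin n → (combVoc a b).Term ℕ) :
    (fun i : Fin (n + 1) => ((Fin.cons t ts : Fin (n + 1) → (combVoc a b).Term ℕ) i).realize s) =
      Fin.cons (t.realize s) fun i => (ts i).realize s := by
  funext i
  refine Fin.cases ?_ (fun i => ?_) i <;> simp

theorem holds_relAtom {n : ℕ} (R : CombRel A B a.T b.T n) (ts : Fin n → (combVoc a b).Term ℕ)
    (s : ℕ → M) : (relAtom a b R ts).Holds W.interp s ↔ W n R fun i => (ts i).realize s :=
  Iff.rfl

variable [A.IsRelational] [A.Structure M]

theorem holds_leftAtom (c : PredAtom (L.sum A)) (s : ℕ → M) :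
    (leftAtom a b c).Holds W.interp s ↔ c.Holds W.left fun n => s (n + 1) := by
  simp only [leftAtom, PredAtom.Holds, realize_liftTerm]
  rfl

theorem holds_tagAtom (f : ∀ n, a.T n → CombRel A B a.T b.T (n + 1)) (c : PredAtom (L.sum A))
    (s : ℕ → M) :
    (tagAtom a b f c).Holds W.interp s ↔ c.Holds (W.tagged f (s 0)) fun n => s (n + 1) := by
  by_cases h : P.Intensional c.pred
  · rw [tagAtom, dif_pos h, holds_relAtom, realize_cons]
    simp only [PredAtom.Holds, CombVal.tagged, Naming.override, h, dite_true, realize_liftTerm]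
    rfl
  · rw [tagAtom, dif_neg h, holds_leftAtom]
    simp [PredAtom.Holds, CombVal.tagged, Naming.override, h]

end

section

variable [(combLang A B a.T b.T).Structure M] {W : CombVal a b M} [B.IsRelational] [B.Structure M]

theorem holds_rightAtom (c : PredAtom (L.sum B)) (s : ℕ → M) :
    (rightAtom a b c).Holds W.interp s ↔ c.Holds W.right fun n => s (n + 1) := by
  simp only [rightAtom, PredAtom.Holds, realize_liftTerm]
  rfl

theorem holds_starAtom (c : PredAtom (L.sum B)) (s : ℕ → M) :
    (starAtom a b c).Holds W.interp s ↔ c.Holds W.starred fun n => s (n + 1) := by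
  by_cases h : Q.Intensional c.pred
  · rw [starAtom, dif_pos h, holds_relAtom]
    simp only [PredAtom.Holds, CombVal.starred, Naming.override, h, dite_true, realize_liftTerm]
  · rw [starAtom, dif_neg h, holds_rightAtom]
    simp [PredAtom.Holds, CombVal.starred, Naming.override, h]

end

end Valuation

end LogicProgram

/-! ### Meaning of each rule, and stability of the combined program -/

namespace LogicProgram

/-- Variables are indexed by pairs, so two argument tuples and a tuple of codes can be assigned
independently. -/
theorem exists_rows {M : Type w} [Nonempty M] {n m k : ℕ} (x : Fin n → M) (y : Fin m → M)
    (z : Fin k → M) : ∃ s : ℕ → M, (∀ i : Fin n, s (Nat.pair 0 i) = x i) ∧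
      (∀ i : Fin m, s (Nat.pair 1 i) = y i) ∧ ∀ i : Fin k, s (Nat.pair 2 i) = z i := by
  have key : ∀ {n : ℕ} (x : Fin n → M), ∃ x' : ℕ → M, ∀ i : Fin n, x' i = x i := fun x =>
    ⟨Function.extend Fin.val x fun _ => Classical.arbitrary M,
      fun i => Fin.val_injective.extend_apply _ _ _⟩
  obtain ⟨x', hx⟩ := key x
  obtain ⟨y', hy⟩ := key y
  obtain ⟨z', hz⟩ := key z
  refine ⟨fun l => if l.unpair.1 = 0 then x' l.unpair.2 else if l.unpair.1 = 1 then
    y' l.unpair.2 else z' l.unpair.2, ?_, ?_, ?_⟩ <;> simp [hx, hy, hz]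

section

variable {L : FirstOrder.Language.{u, v}} {A B : FirstOrder.Language.{0, 0}}
  {P : Program (L.sum A)} {Q : Program (L.sum B)} {a : Naming P} {b : Naming Q}
  {M : Type w} [L.Structure M] [(combLang A B a.T b.T).Structure M] {W V : CombVal a b M}

theorem holds_mkRule (l : Literal (combVoc a b)) (ls : List (Literal (combVoc a b)))
    (hs : List (PredAtom (combVoc a b))) : (mkRule l ls hs).Holds W.interp V.interp ↔
      ∀ s, l.Holds W.interp V.interp s → (∀ l ∈ ls, l.Holds W.interp V.interp s) →
        ∃ c ∈ hs, c.Holds W.interp s := by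
  simp [mkRule, Rule.Holds]

theorem holds_flagLit (s : ℕ → M) :
    (flagLit a b).Holds W.interp V.interp s ↔ W 0 .flag Fin.elim0 := by
  rw [flagLit, Literal.Holds, Atom.Holds, holds_relAtom, realize_nil]

theorem holds_noFlagLit (s : ℕ → M) :
    (noFlagLit a b).Holds W.interp V.interp s ↔ ¬ V 0 .flag Fin.elim0 := by
  rw [noFlagLit, Literal.Holds, Atom.Holds, holds_relAtom, realize_nil]

theorem holds_posLit {n : ℕ} (R : CombRel A B a.T b.T n) (ts : Fin n → (combVoc a b).Term ℕ)
    (s : ℕ → M) : (posLit a b R ts).Holds W.interp V.interp s ↔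
      W n R fun i => (ts i).realize s :=
  Iff.rfl

theorem holds_negLit {n : ℕ} (R : CombRel A B a.T b.T n) (ts : Fin n → (combVoc a b).Term ℕ)
    (s : ℕ → M) : (negLit a b R ts).Holds W.interp V.interp s ↔
      ¬ V n R fun i => (ts i).realize s :=
  Iff.rfl

theorem realize_rowVar (i j : ℕ) (s : ℕ → M) :
    (rowVar i j : (combVoc a b).Term ℕ).realize s = s (Nat.pair i j) :=
  rfl

theorem realize_row (n i : ℕ) (s : ℕ → M) : (fun j => (row n i j :
    (combVoc a b).Term ℕ).realize s) = fun j : Fin n => s (Nat.pair i j) :=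
  rfl

theorem holds_leftRow {n : ℕ} (p : a.T n) (s : ℕ → M) : (leftRow a b p).Holds W.interp s ↔
    W.left n (a.pred p) fun j => s (Nat.pair 0 j) :=
  Iff.rfl

theorem holds_rightRow {n : ℕ} (q : b.T n) (s : ℕ → M) : (rightRow a b q).Holds W.interp s ↔
    W.right n (b.pred q) fun j => s (Nat.pair 0 j) :=
  Iff.rfl

theorem holds_pos (c : PredAtom (combVoc a b)) (s : ℕ → M) :
    (Literal.pos (.pred c)).Holds W.interp V.interp s ↔ c.Holds W.interp s :=
  Iff.rfl

theorem holds_neg (c : PredAtom (combVoc a b)) (s : ℕ → M) :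
    (Literal.neg (.pred c)).Holds W.interp V.interp s ↔ ¬ c.Holds V.interp s :=
  Iff.rfl

theorem holds_neg_eq (t t' : (combVoc a b).Term ℕ) (s : ℕ → M) :
    (Literal.neg (.eq t t')).Holds W.interp V.interp s ↔ t.realize s ≠ t'.realize s :=
  Iff.rfl

theorem holds_loopRule {n : ℕ} (R : CombRel A B a.T b.T n) :
    (loopRule a b R).Holds W.interp V.interp := by
  simp [loopRule, holds_mkRule, holds_pos]

theorem holds_insBody {n m : ℕ} (p : a.T n) (q : a.T m) (s : ℕ → M) :
    (∀ l ∈ insBody a b p q, l.Holds W.interp V.interp s) ↔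
      W _ (.ins p) (Fin.cons (s (Nat.pair 2 0)) (Fin.cons (s (Nat.pair 2 1))
        fun j : Fin n => s (Nat.pair 0 j))) ∧
      W _ (.mem q) (Fin.cons (s (Nat.pair 2 1)) fun j : Fin m => s (Nat.pair 1 j)) ∧
      ¬ V _ (.mem q) (Fin.cons (s (Nat.pair 2 0)) fun j : Fin m => s (Nat.pair 1 j)) := by
  simp only [insBody, List.forall_mem_cons, holds_posLit, holds_negLit, realize_cons, realize_row,
    realize_rowVar, List.not_mem_nil, false_imp_iff, implies_true, and_true]

variable [A.IsRelational] [A.Structure M]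

theorem holds_modelRule (r : Rule (L.sum A)) [Nonempty M] :
    (modelRule a b r).Holds W.interp V.interp ↔
      (¬ V 0 .flag Fin.elim0 → ∀ s : ℕ → M, (∀ l ∈ r.body, l.Holds W.left V.left s) →
        ∃ c ∈ r.head, c.Holds V.left s) := by
  have hl : ∀ (l : Literal (L.sum A)) (s : ℕ → M), (l.lift (leftAtom a b) (leftAtom a b)).Holds
      W.interp V.interp s ↔ l.Holds W.left V.left fun n => s (n + 1) := fun l s =>
    Literal.holds_lift (fun c => holds_leftAtom c s) (fun c => holds_leftAtom c s) l
  simp only [modelRule, holds_mkRule, holds_noFlagLit, List.forall_mem_append, List.forall_mem_map,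
    hl, holds_neg, holds_leftAtom, List.not_mem_nil, false_and, exists_false, imp_false]
  constructor
  · intro h hf s hs
    -- Lifted atoms never mention variable `0`, so its value is arbitrary.
    have := h (fun n => n.casesOn (Classical.arbitrary M) s) hf
    by_contra hc
    push Not at hc
    exact this ⟨hs, hc⟩
  · rintro h s hf ⟨hs, hc⟩
    obtain ⟨c, hc', h'⟩ := h hf _ hs
    exact hc c hc' h'

theorem holds_derRule (r : Rule (L.sum A)) :
    (derRule a b r).Holds W.interp V.interp ↔
      (¬ V 0 .flag Fin.elim0 → ∀ (s : ℕ → M) (d : M),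
        (∀ l ∈ r.body, l.Holds (W.tagged (fun _ p => .dins p) d) V.left s) →
        (∀ c ∈ r.head, c.Holds (W.tagged (fun _ p => .mem p) d) s) → W 1 .der ![d]) := by
  have hl : ∀ (l : Literal (L.sum A)) (s : ℕ → M),
      (l.lift (tagAtom a b fun _ p => .dins p) (leftAtom a b)).Holds W.interp V.interp s ↔
      l.Holds (W.tagged (fun _ p => .dins p) (s 0)) V.left fun n => s (n + 1) := fun l s =>
    Literal.holds_lift (fun c => holds_tagAtom _ c s) (fun c => holds_leftAtom c s) l
  simp only [derRule, holds_mkRule, holds_noFlagLit, List.forall_mem_append, List.forall_mem_map,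
    hl, holds_pos, holds_tagAtom, List.mem_singleton, exists_eq_left, holds_relAtom, realize_one,
    FirstOrder.Language.Term.realize]
  constructor
  · intro h hf s d hs hc
    exact h (fun n => n.casesOn d s) hf ⟨hs, hc⟩
  · rintro h s hf ⟨hs, hc⟩
    exact h hf _ _ hs hc

end

section

variable {L : FirstOrder.Language.{u, v}} {A B : FirstOrder.Language.{0, 0}}
  {P : Program (L.sum A)} {Q : Program (L.sum B)} {a : Naming P} {b : Naming Q}
  {M : Type w} [L.Structure M] [(combLang A B a.T b.T).Structure M] {W V : CombVal a b M}
  [B.IsRelational] [B.Structure M]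

theorem holds_starRule (r : Rule (L.sum B)) [Nonempty M] :
    (starRule a b r).Holds W.interp V.interp ↔
      (W 0 .flag Fin.elim0 → r.Holds W.starred V.right) := by
  have hl : ∀ (l : Literal (L.sum B)) (s : ℕ → M), (l.lift (starAtom a b) (rightAtom a b)).Holds
      W.interp V.interp s ↔ l.Holds W.starred V.right fun n => s (n + 1) := fun l s =>
    Literal.holds_lift (fun c => holds_starAtom c s) (fun c => holds_rightAtom c s) l
  simp only [starRule, holds_mkRule, holds_flagLit, hl, List.mem_map,
    exists_exists_and_eq_and, holds_starAtom, forall_exists_index, and_imp,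
    forall_apply_eq_imp_iff₂]
  constructor
  · intro h hf s hs
    exact h (fun n => n.casesOn (Classical.arbitrary M) s) hf hs
  · intro h s hf hs
    exact h hf _ hs

variable [A.IsRelational] [A.Structure M] [Nonempty M]

theorem CombVal.Sem.of_holds
    (h : ∀ r ∈ combProgram a b, r.Holds W.interp V.interp) : W.Sem V where
  star hf r hr := (holds_starRule r).1 (h _ (.star hr)) hf
  star_le hf n q x hx := by
    obtain ⟨s, hs, -⟩ := exists_rows x x x
    have := (holds_mkRule _ _ _).1 (h _ (.copy (q := q) (Or.inl rfl))) s
    simpa [holds_flagLit, hf, holds_posLit, holds_neg, holds_rightRow, realize_row, hs, hx]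
      using this
  le_star hf n q x hx := by
    obtain ⟨s, hs, -⟩ := exists_rows x x x
    have := (holds_mkRule _ _ _).1 (h _ (.copy (q := q) (Or.inr rfl))) s
    simpa [holds_flagLit, hf, holds_negLit, holds_pos, holds_rightRow, realize_row, hs, hx]
      using this
  next_unique hf x y z h1 h2 := by
    obtain ⟨s, hs, -⟩ := exists_rows ![x, y, z] ![x] ![x]
    have h0 : s (Nat.pair 0 0) = x := hs 0
    have hy : s (Nat.pair 0 1) = y := hs 1
    have hz : s (Nat.pair 0 2) = z := hs 2
    have := (holds_mkRule _ _ _).1 (h _ (.finite (Or.inl rfl))) s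
    simpa [holds_flagLit, hf, holds_posLit, realize_two, realize_rowVar, holds_neg_eq,
      h0, hy, hz, h1, h2] using this
  reach_base hf x y h1 := by
    obtain ⟨s, hs, -⟩ := exists_rows ![x, y] ![x] ![x]
    have h0 : s (Nat.pair 0 0) = x := hs 0
    have hy : s (Nat.pair 0 1) = y := hs 1
    have := (holds_mkRule _ _ _).1 (h _ (.finite (Or.inr (Or.inl rfl)))) s
    simpa [holds_flagLit, hf, holds_posLit, realize_two, realize_rowVar, holds_relAtom,
      h0, hy, h1] using this
  reach_step hf x y z h1 h2 := by
    obtain ⟨s, hs, -⟩ := exists_rows ![x, y, z] ![x] ![x]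
    have h0 : s (Nat.pair 0 0) = x := hs 0
    have hy : s (Nat.pair 0 1) = y := hs 1
    have hz : s (Nat.pair 0 2) = z := hs 2
    have := (holds_mkRule _ _ _).1 (h _ (.finite (Or.inr (Or.inr (Or.inl rfl))))) s
    simpa [holds_flagLit, hf, holds_posLit, realize_two, realize_rowVar, holds_relAtom,
      h0, hy, hz, h1, h2] using this
  reach_all hf x y := by
    obtain ⟨s, hs, -⟩ := exists_rows ![x, y] ![x] ![x]
    have h0 : s (Nat.pair 0 0) = x := hs 0
    have hy : s (Nat.pair 0 1) = y := hs 1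
    have := (holds_mkRule _ _ _).1 (h _ (.finite (Or.inr (Or.inr (Or.inr rfl))))) s
    simpa [holds_flagLit, hf, holds_negLit, realize_two, realize_rowVar, h0, hy] using this
  model hf r hr := (holds_modelRule r).1 (h _ (.model hr)) hf
  ins hf n p m q d d' x y h1 h2 h3 := by
    obtain ⟨s, hx, hy, hz⟩ := exists_rows x y ![d, d']
    have hd : s (Nat.pair 2 0) = d := hz 0
    have hd' : s (Nat.pair 2 1) = d' := hz 1
    -- Distinct ground atoms differ in their predicate or in some argument; each case has its own
    -- constraint.
    by_cases hpq : (⟨n, p⟩ : Σ n, a.T n) = ⟨m, q⟩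
    · obtain ⟨rfl, hpq⟩ := Sigma.mk.inj hpq
      obtain rfl := eq_of_heq hpq
      by_contra hne
      obtain ⟨i, hi⟩ : ∃ i, x i ≠ y i := by
        by_contra hc
        push Not at hc
        exact hne (by rw [funext hc])
      have := (holds_mkRule _ _ _).1 (h _ (.insEq (p := p) i)) s
      rw [List.forall_mem_cons, holds_insBody] at this
      simp [holds_noFlagLit, hf, realize_rowVar, holds_neg_eq, hx, hy, hd, hd', h1, h2, h3, hi]
        at this
    · have := (holds_mkRule _ _ _).1 (h _ (.insNe hpq)) s
      rw [holds_insBody] at this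
      simp [holds_noFlagLit, hf, hx, hy, hd, hd', h1, h2, h3] at this
  emp hf n p e x h1 h2 h3 := by
    obtain ⟨s, hx, -, hz⟩ := exists_rows x x ![e]
    have he : s (Nat.pair 2 0) = e := hz 0
    have := (holds_mkRule _ _ _).1 (h _ (.emp (p := p))) s
    simp [holds_noFlagLit, hf, holds_posLit, realize_one, -Matrix.cons_val_fin_one, realize_rowVar, realize_cons,
      realize_row, holds_pos, holds_leftRow, hx, he, h1, h2, h3] at this
  dins hf n p d d' x h1 h2 := by
    obtain ⟨s, hx, -, hz⟩ := exists_rows x x ![d, d']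
    have hd : s (Nat.pair 2 0) = d := hz 0
    have hd' : s (Nat.pair 2 1) = d' := hz 1
    have := (holds_mkRule _ _ _).1 (h _ (.dins (p := p))) s
    simpa [holds_noFlagLit, hf, holds_posLit, realize_one, -Matrix.cons_val_fin_one, realize_rowVar, realize_cons,
      realize_row, holds_relAtom, hx, hd, hd', h1, h2] using this
  der hf r hr := (holds_derRule r).1 (h _ (.der hr)) hf
  ok hf n p e x h1 h2 := by
    obtain ⟨s, hx, -, hz⟩ := exists_rows x x ![e]
    have he : s (Nat.pair 2 0) = e := hz 0
    have := (holds_mkRule _ _ _).1 (h _ (.ok (p := p))) s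
    simpa [holds_noFlagLit, hf, holds_posLit, realize_one, -Matrix.cons_val_fin_one, realize_rowVar, realize_cons,
      realize_row, holds_relAtom, hx, he, h1, h2] using this
  support hf n p x h1 := by
    obtain ⟨s, hx, -⟩ := exists_rows x x x
    have := (holds_mkRule _ _ _).1 (h _ (.support (p := p))) s
    simpa [holds_noFlagLit, hf, holds_negLit, realize_row, holds_pos, holds_leftRow, hx, h1]
      using this

theorem CombVal.Sem.holds (h : W.Sem V) : ∀ r ∈ combProgram a b, r.Holds W.interp V.interp := by
  intro r hr
  cases hr with
  | loop _ => exact holds_loopRule _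
  | star hr => exact (holds_starRule _).2 fun hf => h.star hf _ hr
  | model hr => exact (holds_modelRule _).2 fun hf => h.model hf _ hr
  | der hr => exact (holds_derRule _).2 fun hf => h.der hf _ hr
  | finite hr =>
    rcases hr with rfl | rfl | rfl | rfl
    · simpa [holds_mkRule, holds_flagLit, holds_posLit, realize_two, realize_rowVar, holds_neg_eq]
        using fun s hf h1 h2 => h.next_unique hf _ _ _ h1 h2
    · simpa [holds_mkRule, holds_flagLit, holds_posLit, realize_two, realize_rowVar, holds_relAtom]
        using fun s hf h1 => h.reach_base hf _ _ h1
    · simpa [holds_mkRule, holds_flagLit, holds_posLit, realize_two, realize_rowVar, holds_relAtom]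
        using fun s hf h1 h2 => h.reach_step hf _ _ _ h1 h2
    · simpa [holds_mkRule, holds_flagLit, holds_negLit, realize_two, realize_rowVar]
        using fun s hf => h.reach_all hf _ _
  | copy hr =>
    rcases hr with rfl | rfl
    · simpa [holds_mkRule, holds_flagLit, holds_posLit, holds_neg, holds_rightRow, realize_row]
        using fun s hf h1 => h.star_le hf _ _ _ h1
    · simpa [holds_mkRule, holds_flagLit, holds_negLit, holds_pos, holds_rightRow, realize_row]
        using fun s hf h1 => h.le_star hf _ _ _ h1
  | insNe hpq =>
    refine (holds_mkRule _ _ _).2 fun s hf hb => ?_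
    rw [holds_insBody] at hb
    have := h.ins ((holds_noFlagLit s).1 hf) _ _ _ _ _ _ _ _ hb.1 hb.2.1 hb.2.2
    refine absurd ?_ hpq
    exact congrArg (fun z : Σ n, a.T n × (Fin n → M) => (⟨z.1, z.2.1⟩ : Σ n, a.T n)) this
  | insEq i =>
    refine (holds_mkRule _ _ _).2 fun s hf hb => ?_
    rw [List.forall_mem_cons, holds_insBody] at hb
    have := h.ins ((holds_noFlagLit s).1 hf) _ _ _ _ _ _ _ _ hb.2.1 hb.2.2.1 hb.2.2.2
    simp only [Sigma.mk.injEq, heq_eq_eq, Prod.mk.injEq, true_and] at this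
    exact absurd (congrFun this i) hb.1
  | emp =>
    simpa [empRule, holds_mkRule, holds_noFlagLit, holds_posLit, realize_one, -Matrix.cons_val_fin_one, realize_rowVar,
      realize_cons, realize_row, holds_pos, holds_leftRow]
      using fun s hf h1 h2 => h.emp hf _ _ _ _ h1 h2
  | dins =>
    simpa [dinsRule, holds_mkRule, holds_noFlagLit, holds_posLit, realize_one, -Matrix.cons_val_fin_one, realize_rowVar,
      realize_cons, realize_row, holds_relAtom]
      using fun s hf h1 h2 => h.dins hf _ _ _ _ _ h1 h2
  | ok =>
    simpa [okRule, holds_mkRule, holds_noFlagLit, holds_posLit, realize_one, -Matrix.cons_val_fin_one, realize_rowVar,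
      realize_cons, realize_row, holds_relAtom]
      using fun s hf h1 h2 => h.ok hf _ _ _ _ h1 h2
  | support =>
    simpa [supportRule, holds_mkRule, holds_noFlagLit, holds_negLit, realize_row, holds_pos,
      holds_leftRow] using fun s hf h1 => h.support hf _ _ _ h1

/-- Stability of the combined program in terms of interpretations of the auxiliary predicates. -/
theorem stableModel_combProgram_iff
    (hV : ∀ n (c : CombRel A B a.T b.T n) (x : Fin n → M),
      structInterp (combLang A B a.T b.T) M n c x ↔ V n c x) :
    (combProgram a b).StableModel M ↔ V.Sem V ∧ ∀ W : CombVal a b M,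
      (∀ n c x, W n c x → V n c x) →
      (∀ n (c : CombRel A B a.T b.T n), ¬ c.IsHead → ∀ x, V n c x → W n c x) →
      W.Sem V → ∀ n c x, V n c x → W n c x := by
  have hI : structInterp (combVoc a b) M = V.interp := by
    funext n R x
    rcases R with R | R
    · rfl
    · exact propext (hV n R x)
  rw [Program.stableModel_iff, hI]
  refine and_congr ⟨CombVal.Sem.of_holds, CombVal.Sem.holds⟩
    ⟨fun h W hle hext hW n c x hx => ?_, fun h X hle hext hX n R x hx => ?_⟩
  · refine h W.interp ?_ ?_ hW.holds n (Sum.inr c) x hx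
    · rintro n (R | R) x hx
      · exact hx
      · exact hle n R x hx
    · rintro n (R | R) hR x hx
      · exact hx
      · exact hext n R (fun hc => hR ((intensional_combProgram a b _).2 ⟨R, hc, rfl⟩)) x hx
  · let W : CombVal a b M := fun n c x => X n (Sum.inr c) x
    -- No symbol of `L` is intensional in the combined program, so `X` cannot shrink it.
    have hinl : ∀ n (R : L.Relations n) x, structInterp L M n R x → X n (Sum.inl R) x :=
      fun n R x hx => hext n (Sum.inl R) (fun hc => by
        obtain ⟨c, -, he⟩ := (intensional_combProgram a b _).1 hc
        cases he) x hx
    have hXW : X = W.interp := by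
      funext n R x
      rcases R with R | R
      · exact propext ⟨hle n (Sum.inl R) x, hinl n R x⟩
      · rfl
    rcases R with R | R
    · exact hinl n R x hx
    · refine h W (fun n c x => hle n (Sum.inr c) x) (fun n c hc x hx => ?_)
        (CombVal.Sem.of_holds (by rwa [← hXW])) n R x hx
      refine hext n (Sum.inr c) (fun hc' => ?_) x hx
      obtain ⟨c', hc'', he⟩ := (intensional_combProgram a b _).1 hc'
      cases he
      exact hc hc''

end

end LogicProgram

/-! ### Soundness: what a stable combined interpretation implies -/

namespace LogicProgram

/-- The point `x` is periodic because it reaches itself, and its orbit is everything. -/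
theorem finite_of_iterate_eq {M : Type w} (F : M → M)
    (h : ∀ x y, ∃ k : ℕ, F^[k + 1] x = y) (x : M) : Finite M := by
  obtain ⟨k, hk⟩ := h x x
  have hp : Function.IsPeriodicPt F (k + 1) x := hk
  refine Finite.of_surjective (fun i : Fin (k + 1) => F^[i] x) fun y => ?_
  obtain ⟨l, hl⟩ := h x y
  exact ⟨⟨(l + 1) % (k + 1), Nat.mod_lt _ k.succ_pos⟩, by
    simpa only [hp.iterate_mod_apply] using hl⟩

variable {L : FirstOrder.Language.{u, v}} {A B : FirstOrder.Language.{0, 0}}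
  {P : Program (L.sum A)} {Q : Program (L.sum B)} {a : Naming P} {b : Naming Q}
  {M : Type w} [L.Structure M]

/-- The stability condition for the combined program. -/
def CombVal.Stable [A.Structure M] [B.Structure M] (V : CombVal a b M) : Prop :=
  V.Sem V ∧ ∀ W : CombVal a b M,
    (∀ n c x, W n c x → V n c x) →
    (∀ n (c : CombRel A B a.T b.T n), ¬ c.IsHead → ∀ x, V n c x → W n c x) →
    W.Sem V → ∀ n c x, V n c x → W n c x

theorem CombVal.right_eq [B.Structure M] {V : CombVal a b M}
    (hB : ∀ n R x, V n (.right R) x ↔ structInterp B M n R x) :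
    V.right = structInterp (L.sum B) M := by
  funext n R x
  rcases R with R | R
  · rfl
  · exact propext (hB n R x)

theorem CombVal.left_eq [A.Structure M] {V : CombVal a b M}
    (hA : ∀ n R x, V n (.left R) x ↔ structInterp A M n R x) :
    V.left = structInterp (L.sum A) M := by
  funext n R x
  rcases R with R | R
  · rfl
  · exact propext (hA n R x)

/-- If the copies are read as the intensional predicates in `X`, then `W.starred` is `X`. -/
theorem CombVal.starred_eq [B.Structure M] {W : CombVal a b M} {X : PredInterp (L.sum B) M}
    (hs : ∀ n t x, W n (.star t) x ↔ X n (b.pred t) x)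
    (hX : ∀ n R, ¬ Q.Intensional R → ∀ x, W.right n R x ↔ X n R x) : W.starred = X := by
  funext n R x
  apply propext
  by_cases h : Q.Intensional R
  · obtain ⟨t, rfl⟩ := b.exists_pred h
    rw [CombVal.starred, Naming.override_pred, hs]
  · rw [CombVal.starred, Naming.override_of_not _ _ _ h, hX n R h]

section

variable [A.Structure M] [B.Structure M] {V : CombVal a b M}

/-- Cutting `reach` down to pairs joined by iterating the partial function `next` preserves the
rules. By minimality nothing is lost, and `reach` is total. -/
theorem CombVal.Stable.finite [Nonempty M] (hV : V.Stable) (hf : V 0 .flag Fin.elim0) : Finite M := by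
  classical
  -- The value where `next` is undefined is irrelevant: only `next` edges are followed.
  let F : M → M := fun x => if h : ∃ y, V 2 .next ![x, y] then h.choose else x
  have hF : ∀ x y, V 2 .next ![x, y] → F x = y := by
    intro x y hxy
    have h : ∃ y, V 2 .next ![x, y] := ⟨y, hxy⟩
    simp only [F, h, dite_true]
    exact hV.1.next_unique hf x _ _ h.choose_spec hxy
  let W : CombVal a b M := fun n c x =>
    match n, c, x with
    | _, .reach, x => V _ .reach x ∧ ∃ k : ℕ, F^[k + 1] (x 0) = x 1
    | _, c, x => V _ c x
  have hWr : W.right = V.right := by funext n R x; cases R <;> rfl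
  have hWs : W.starred = V.starred := by rw [CombVal.starred, CombVal.starred, hWr]
  have hW : W.Sem V :=
    { star := fun hf r hr => by rw [hWs]; exact hV.1.star hf r hr
      star_le := hV.1.star_le
      le_star := by rw [hWr]; exact hV.1.le_star
      next_unique := hV.1.next_unique
      reach_base := fun hf x y h => ⟨hV.1.reach_base hf x y h, 0, hF x y h⟩
      reach_step := by
        rintro hf x y z ⟨h1, k, hk⟩ h2
        refine ⟨hV.1.reach_step hf x y z h1 h2, k + 1, ?_⟩
        rw [Function.iterate_succ_apply']
        exact (congrArg F hk).trans (hF y z h2)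
      reach_all := hV.1.reach_all
      model := fun h => absurd hf h
      ins := fun h => absurd hf h
      emp := fun h => absurd hf h
      dins := fun h => absurd hf h
      der := fun h => absurd hf h
      ok := fun h => absurd hf h
      support := fun h => absurd hf h }
  refine finite_of_iterate_eq F (fun x y => ?_) (Classical.arbitrary M)
  refine (hV.2 W ?_ ?_ hW 2 .reach ![x, y] (hV.1.reach_all hf x y)).2
  · intro n c x h
    cases c with
    | reach => exact h.1
    | _ => exact h
  · intro n c hc x h
    cases c with
    | reach => exact absurd True.intro hc
    | _ => exact h

/-- A smaller model of the reduct of `Q` can be substituted for the copies without violating a rule,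
so minimality excludes it. -/
theorem CombVal.Stable.right_stable (hV : V.Stable) (hf : V 0 .flag Fin.elim0)
    (hB : ∀ n R x, V n (.right R) x ↔ structInterp B M n R x) : Q.StableModel M := by
  have hr := CombVal.right_eq hB
  have hs : ∀ n (t : b.T n) x, V n (.star t) x ↔ structInterp (L.sum B) M n (b.pred t) x := by
    intro n t x
    rw [← hr]
    exact ⟨hV.1.star_le hf n t x, hV.1.le_star hf n t x⟩
  rw [Program.stableModel_iff]
  refine ⟨fun r hrQ => ?_, fun X hle hext hX n R x hx => ?_⟩
  · have := hV.1.star hf r hrQ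
    rwa [CombVal.starred_eq hs fun n R _ x => by rw [hr], hr] at this
  · let W : CombVal a b M := fun n c x =>
      match n, c, x with
      | n, .star t, x => X n (b.pred t) x
      | _, c, x => V _ c x
    have hWr : W.right = V.right := by funext n R x; cases R <;> rfl
    have hWs : W.starred = X := CombVal.starred_eq (fun n t x => Iff.rfl) fun n R hR x => by
      rw [hWr, hr]
      exact ⟨hext n R hR x, hle n R x⟩
    have hW : W.Sem V :=
      { star := fun _ r hrQ => by rw [hWs, hr]; exact hX r hrQ
        star_le := fun _ n t x h => by rw [hr]; exact hle _ _ _ h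
        le_star := by rw [hWr]; exact hV.1.le_star
        next_unique := hV.1.next_unique
        reach_base := hV.1.reach_base
        reach_step := hV.1.reach_step
        reach_all := hV.1.reach_all
        model := fun h => absurd hf h
        ins := fun h => absurd hf h
        emp := fun h => absurd hf h
        dins := fun h => absurd hf h
        der := fun h => absurd hf h
        ok := fun h => absurd hf h
        support := fun h => absurd hf h }
    by_cases hR : Q.Intensional R
    · obtain ⟨t, rfl⟩ := b.exists_pred hR
      refine hV.2 W ?_ ?_ hW n (.star t) x ((hs n t x).2 hx)
      · intro n c x h
        cases c with
        | star t => exact (hs _ _ _).2 (hle _ _ _ h)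
        | _ => exact h
      · intro n c hc x h
        cases c with
        | star t => exact absurd True.intro hc
        | _ => exact h
    · exact hext n R hR x hx

/-- Given a submodel `X` of the reduct, discard all derivability claims about sets that `X` misses.
The rules survive, so by minimality every `ok` atom lies in `X`, and every true intensional atom is
`ok`. -/
theorem CombVal.Stable.left_stable (hV : V.Stable) (hf : ¬ V 0 .flag Fin.elim0)
    (hA : ∀ n R x, V n (.left R) x ↔ structInterp A M n R x) : P.StableModel M := by
  have hl := CombVal.left_eq hA
  rw [Program.stableModel_iff]
  refine ⟨fun r hr s hs => ?_, fun X hle hext hX n R x hx => ?_⟩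
  · rw [← hl] at hs ⊢
    exact hV.1.model hf r hr s hs
  · let hit : M → Prop := fun d => ∃ (n : ℕ) (p : a.T n) (x : Fin n → M),
      V _ (.mem p) (Fin.cons d x) ∧ X n (a.pred p) x
    let W : CombVal a b M := fun n c x =>
      match n, c, x with
      | _, .der, x => V _ .der x ∧ hit (x 0)
      | _, .dins p, x => V _ (.dins p) x ∧ (X _ (a.pred p) (Fin.tail x) ∨ hit (x 0))
      | _, .ok p, x => V _ (.ok p) x ∧ X _ (a.pred p) x
      | _, c, x => V _ c x
    have hWl : W.left = V.left := by funext n R x; cases R <;> rfl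
    have hW : W.Sem V :=
      { star := fun h => absurd h hf
        star_le := fun h => absurd h hf
        le_star := fun h => absurd h hf
        next_unique := fun h => absurd h hf
        reach_base := fun h => absurd h hf
        reach_step := fun h => absurd h hf
        reach_all := fun h => absurd h hf
        model := by rw [hWl]; exact hV.1.model
        ins := hV.1.ins
        emp := by rw [hWl]; exact hV.1.emp
        dins := by
          rintro - n p d d' x h1 ⟨h2, m, q, y, hq, hy⟩
          -- An atom of `X` in the set of `d'` is in the set of `d` or is `p(x)` itself.
          refine ⟨hV.1.dins hf n p d d' x h1 h2, ?_⟩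
          by_cases hm : V _ (.mem q) (Fin.cons d y)
          · exact Or.inr ⟨m, q, y, hm, hy⟩
          · cases hV.1.ins hf n p m q d d' x y h1 hq hm
            exact Or.inl hy
        der := by
          intro _ r hr s d hb hh
          have hmem : ∀ c ∈ r.head, ∃ p : a.T c.arity, a.pred p = c.pred ∧
              V _ (.mem p) (Fin.cons d fun i => (c.args i).realize s) := by
            intro c hc
            obtain ⟨p, hp⟩ := a.exists_pred (Program.intensional_of_mem_head hr hc)
            refine ⟨p, hp, ?_⟩
            have := hh c hc
            rw [PredAtom.Holds, ← hp, CombVal.tagged, Naming.override_pred] at this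
            exact this
          refine ⟨hV.1.der hf r hr s d (fun l hlb => ?_) (fun c hc => ?_), ?_⟩
          · refine Literal.holds_of_imp (hb l hlb) fun c _ h => ?_
            by_cases hc : P.Intensional c.pred
            · obtain ⟨p, hp⟩ := a.exists_pred hc
              rw [PredAtom.Holds, ← hp, CombVal.tagged, Naming.override_pred] at h ⊢
              exact h.1
            · rw [PredAtom.Holds, CombVal.tagged, Naming.override_of_not _ _ _ hc] at h ⊢
              rwa [hWl] at h
          · obtain ⟨p, hp, hm⟩ := hmem c hc
            rw [PredAtom.Holds, ← hp, CombVal.tagged, Naming.override_pred]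
            exact hm
          -- If `X` misses the set of `d`, each `dins` premise puts its body atom in `X`. Then `X`
          -- contains a head atom, which belongs to the set of `d`.
          · by_contra hd
            obtain ⟨c, hc, hXc⟩ := hX r hr s fun l hlb => by
              have := hb l hlb
              rw [hl] at this
              refine Literal.holds_of_imp this fun c _ h => ?_
              by_cases hc : P.Intensional c.pred
              · obtain ⟨p, hp⟩ := a.exists_pred hc
                rw [PredAtom.Holds, ← hp, CombVal.tagged, Naming.override_pred] at h
                rw [PredAtom.Holds, ← hp]
                exact h.2.resolve_right hd
              · rw [PredAtom.Holds, CombVal.tagged, Naming.override_of_not _ _ _ hc, hWl, hl] at h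
                exact hext _ _ hc _ h
            obtain ⟨p, hp, hm⟩ := hmem c hc
            refine hd ⟨_, p, _, hm, ?_⟩
            rw [hp]
            exact hXc
        ok := by
          rintro - n p e x h1 ⟨h2, h3⟩
          -- `X` contains only true atoms, so it cannot meet the set coded by `e`; what it meets is
          -- `p(x)`.
          refine ⟨hV.1.ok hf n p e x h1 h2, h3.resolve_right ?_⟩
          rintro ⟨m, q, y, hq, hy⟩
          refine hV.1.emp hf m q e y h1 hq ?_
          rw [hl]
          exact hle _ _ _ hy
        support := by rw [hWl]; exact hV.1.support }
    by_cases hR : P.Intensional R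
    · obtain ⟨p, rfl⟩ := a.exists_pred hR
      refine (hV.2 W ?_ ?_ hW n (.ok p) x (hV.1.support hf n p x (by rwa [hl]))).2
      · intro n c x h
        cases c with
        | der => exact h.1
        | dins p => exact h.1
        | ok p => exact h.1
        | _ => exact h
      · intro n c hc x h
        cases c with
        | der => exact absurd True.intro hc
        | dins p => exact absurd True.intro hc
        | ok p => exact absurd True.intro hc
        | _ => exact h
    · exact hext n R hR x hx

end

end LogicProgram

/-! ### Derivations of finite disjunctions -/

namespace LogicProgram

/-- Merges the finite witnesses belonging to the literals of one rule: the conditions are monotone,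
so the union serves. -/
theorem exists_finset_forall_mem {ι α : Type*} {Z : Set α} {R : ι → Finset α → Prop}
    (hR : ∀ i D D', D ⊆ D' → R i D → R i D') (l : List ι)
    (h : ∀ i ∈ l, ∃ D : Finset α, ↑D ⊆ Z ∧ R i D) :
    ∃ D : Finset α, ↑D ⊆ Z ∧ ∀ i ∈ l, R i D := by
  classical
  induction l with
  | nil => exact ⟨∅, by simp, by simp⟩
  | cons i l ih =>
    obtain ⟨D, hD, hi⟩ := h i (by simp)
    obtain ⟨D', hD', hl⟩ := ih fun j hj => h j (List.mem_cons_of_mem _ hj)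
    refine ⟨D ∪ D', by simp [hD, hD'], fun j hj => ?_⟩
    rcases List.mem_cons.1 hj with rfl | hj
    · exact hR _ _ _ Finset.subset_union_left hi
    · exact hR _ _ _ Finset.subset_union_right (hl j hj)

section Derivation

variable {K : FirstOrder.Language.{u, v}} {P : Program K} (a : Naming P) (M : Type w)

/-- The ground atoms of the intensional predicates of a program. -/
abbrev GroundAtom := Σ n, a.T n × (Fin n → M)

/-- The finite subsets of an infinite type suffice to code the finite sets of ground atoms. -/
theorem exists_surjective_finset_groundAtom [Infinite M] :
    ∃ g : M → Finset (GroundAtom a M), Function.Surjective g := by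
  have := a.finite
  obtain ⟨e, he⟩ := exists_injective_nat (Σ n, a.T n)
  let f : GroundAtom a M → List M := fun c =>
    Infinite.natEmbedding M (e ⟨c.1, c.2.1⟩) :: List.ofFn c.2.2
  have hf : Function.Injective f := by
    rintro ⟨n, p, x⟩ ⟨m, q, y⟩ h
    simp only [f, List.cons.injEq, EmbeddingLike.apply_eq_iff_eq] at h
    obtain ⟨rfl, h1⟩ := Sigma.mk.inj (he h.1)
    obtain rfl := eq_of_heq h1
    rw [List.ofFn_injective h.2]
  -- Lists over an infinite `M`, and finite sets of such lists, are no more numerous than `M`.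
  have hc : Cardinal.mk (Finset (GroundAtom a M)) ≤ Cardinal.mk M := by
    calc Cardinal.mk (Finset (GroundAtom a M)) ≤ Cardinal.mk (Finset (List M)) :=
          Cardinal.mk_le_of_injective (Finset.map_injective ⟨f, hf⟩)
      _ = Cardinal.mk M := by rw [Cardinal.mk_finset_of_infinite, Cardinal.mk_list_eq_mk]
  obtain ⟨i⟩ := Cardinal.le_def _ _ |>.1 hc
  exact ⟨Function.invFun i, Function.invFun_surjective i.injective⟩

variable [K.Structure M]

variable {a M} in
/-- The truth of a ground atom. -/
def GroundAtom.True (c : GroundAtom a M) : Prop := structInterp K M c.1 (a.pred c.2.1) c.2.2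

open Classical in
/-- Derivability, from the ground rules of a program, of the disjunction of a finite set of ground
atoms. -/
inductive Derives : Finset (GroundAtom a M) → Prop
  | step (r : Rule K) (hr : r ∈ P) (s : ℕ → M) (D : Finset (GroundAtom a M))
      -- Reading intensional predicates as true leaves here only negative literals, equations and
      -- extensional atoms; positive intensional atoms are treated in `hbody`.
      (hlit : ∀ l ∈ r.body, l.Holds (a.override (fun _ _ _ => True) (structInterp K M))
        (structInterp K M) s)
      (hbody : ∀ c, .pos (.pred c) ∈ r.body → ∀ p : a.T c.arity, a.pred p = c.pred →
        Derives (insert ⟨c.arity, p, fun i => (c.args i).realize s⟩ D))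
      (hhead : ∀ c ∈ r.head, ∀ p : a.T c.arity, a.pred p = c.pred →
        (⟨c.arity, p, fun i => (c.args i).realize s⟩ : GroundAtom a M) ∈ D) : Derives D

variable {a M}

theorem Derives.mono {D D' : Finset (GroundAtom a M)} (h : Derives a M D) (hD : D ⊆ D') :
    Derives a M D' := by
  classical
  induction h generalizing D' with
  | step r hr s D hlit hbody hhead ih =>
    exact .step r hr s D' hlit (fun c hc p hp => ih c hc p hp (Finset.insert_subset_insert _ hD))
      fun c hc p hp => hD (hhead c hc p hp)

/-- In a stable model each true ground atom is derivable, modulo false ones. -/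
theorem Program.StableModel.exists_derives (hP : P.StableModel M) (c₀ : GroundAtom a M)
    (h₀ : c₀.True) : ∃ D : Finset (GroundAtom a M), (∀ c ∈ D, c.True → c = c₀) ∧ Derives a M D := by
  classical
  by_contra hno
  push Not at hno
  rw [Program.stableModel_iff] at hP
  -- `Z` is maximal among sets without derivable finite subsets that contain `c₀` and all false
  -- atoms. Chains have unions because a finite subset of the union lies in one member.
  obtain ⟨Z, hZ₀, hZ⟩ := zorn_subset_nonempty
    {Z : Set (GroundAtom a M) | ∀ D : Finset (GroundAtom a M), ↑D ⊆ Z → ¬ Derives a M D}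
    (fun C hC hCc hCn => ⟨⋃₀ C, fun D hD => by
      obtain ⟨Z, hZ, hDZ⟩ := DirectedOn.exists_mem_subset_of_finset_subset_biUnion
        (f := id) hCn hCc.directedOn (s := D) (by simpa [Set.sUnion_eq_biUnion] using hD)
      exact hC hZ D hDZ, fun Z hZ => Set.subset_sUnion_of_mem hZ⟩)
    {c | c.True → c = c₀} (fun D hD => hno D fun c hc => hD hc)
  have hnot : ∀ c : GroundAtom a M, c ∉ Z →
      ∃ D : Finset (GroundAtom a M), ↑D ⊆ Z ∧ Derives a M (insert c D) := by
    intro c hc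
    by_contra hn
    push Not at hn
    refine hc (hZ.2 (y := insert c Z) (fun D hD hder => ?_) (Set.subset_insert _ _)
      (Set.mem_insert _ _))
    refine hn (D.erase c) (fun x hx => ?_) (hder.mono (Finset.insert_erase_subset c D))
    have hx := Finset.mem_erase.1 hx
    exact (hD hx.2).resolve_left hx.1
  -- The true atoms outside `Z` will form a model of the reduct; stability then puts `c₀` outside
  -- `Z`, a contradiction.
  let X : PredInterp K M := a.override (fun n p x => structInterp K M n (a.pred p) x ∧
    (⟨n, p, x⟩ : GroundAtom a M) ∉ Z) (structInterp K M)
  have hX : ∀ n R x, structInterp K M n R x → X n R x := by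
    refine hP.2 X (fun n R x h => ?_) (fun n R hR x h => ?_) fun r hr s hs => ?_
    · by_cases hR : P.Intensional R
      · obtain ⟨p, rfl⟩ := a.exists_pred hR
        exact ((Naming.override_pred _ _ _ _ _).1 h).1
      · exact (Naming.override_of_not _ _ _ hR _).1 h
    · exact (Naming.override_of_not _ _ _ hR _).2 h
    · by_contra hc
      push Not at hc
      -- Suppose a rule fails in `X`. Its head atoms are false or in `Z`, hence in `Z` in either
      -- case.
      obtain ⟨D₁, hD₁, hhead⟩ := exists_finset_forall_mem (Z := Z)
        (R := fun (c : PredAtom K) D => ∀ p : a.T c.arity, a.pred p = c.pred →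
          (⟨c.arity, p, fun i => (c.args i).realize s⟩ : GroundAtom a M) ∈ D)
        (fun c D D' hD h p hp => hD (h p hp)) r.head fun c hch => by
          obtain ⟨p, hp⟩ := a.exists_pred (Program.intensional_of_mem_head hr hch)
          refine ⟨{⟨c.arity, p, fun i => (c.args i).realize s⟩}, ?_, ?_⟩
          · rw [Finset.coe_singleton, Set.singleton_subset_iff]
            by_contra hcZ
            have hcX := hc c hch
            rw [PredAtom.Holds, ← hp] at hcX
            exact hcZ (hZ₀ fun ht => absurd ((Naming.override_pred _ _ _ _ _).2 ⟨ht, hcZ⟩) hcX)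
          · intro q hq
            have : q = p := (a.equiv _).injective (Subtype.ext (hq.trans hp.symm))
            rw [this]
            exact Finset.mem_singleton_self _
      -- Its positive intensional body atoms are outside `Z`, so by maximality each becomes
      -- derivable together with a finite part of `Z`. One further inference derives a finite subset
      -- of `Z`.
      obtain ⟨D₂, hD₂, hbody⟩ := exists_finset_forall_mem (Z := Z)
        (R := fun (l : Literal K) D => ∀ c, l = .pos (.pred c) → ∀ p : a.T c.arity,
          a.pred p = c.pred →
          Derives a M (insert ⟨c.arity, p, fun i => (c.args i).realize s⟩ D))
        (fun l D D' hD h c hlc p hp => (h c hlc p hp).mono (Finset.insert_subset_insert _ hD))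
        r.body fun l hl => by
          by_cases hlc : ∃ c, l = .pos (.pred c) ∧ ∃ p : a.T c.arity, a.pred p = c.pred
          · obtain ⟨c, rfl, p, hp⟩ := hlc
            have hcX : c.Holds X s := hs _ hl
            rw [PredAtom.Holds, ← hp] at hcX
            obtain ⟨D, hD, hder⟩ := hnot _ ((Naming.override_pred _ _ _ _ _).1 hcX).2
            refine ⟨D, hD, fun c' hc' q hq => ?_⟩
            cases hc'
            have : q = p := (a.equiv _).injective (Subtype.ext (hq.trans hp.symm))
            rwa [this]
          · exact ⟨∅, by simp, fun c hc p hp => absurd ⟨c, hc, p, hp⟩ hlc⟩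
      refine hZ.1 (D₁ ∪ D₂) (by simp [hD₁, hD₂]) (.step r hr s _ (fun l hl => ?_) ?_ ?_)
      · refine Literal.holds_of_imp (hs l hl) fun c _ h => ?_
        by_cases hR : P.Intensional c.pred
        · obtain ⟨p, hp⟩ := a.exists_pred hR
          rw [PredAtom.Holds, ← hp, Naming.override_pred]
          trivial
        · exact (Naming.override_of_not _ _ _ hR _).2 
            ((Naming.override_of_not _ _ _ hR _).1 (show X c.arity c.pred _ from h))
      · intro c hcb p hp
        exact (hbody _ hcb c rfl p hp).mono
          (Finset.insert_subset_insert _ Finset.subset_union_right)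
      · exact fun c hch p hp => Finset.mem_union_left _ (hhead c hch p hp)
  obtain ⟨n, p, x⟩ := c₀
  have := (Naming.override_pred _ _ _ _ _).1 (hX n (a.pred p) x h₀)
  exact this.2 (hZ₀ fun _ => rfl)

end Derivation

/-! ### Completeness: constructing stable combined interpretations -/

variable {L : FirstOrder.Language.{u, v}} {A B : FirstOrder.Language.{0, 0}}
  {P : Program (L.sum A)} {Q : Program (L.sum B)} (a : Naming P) (b : Naming Q)
  {M : Type w} [L.Structure M]

theorem CombVal.right_congr {a : Naming P} {b : Naming Q} {V W : CombVal a b M}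
    (hle : ∀ n c x, W n c x → V n c x)
    (hext : ∀ n (c : CombRel A B a.T b.T n), ¬ c.IsHead → ∀ x, V n c x → W n c x) :
    W.right = V.right := by
  funext n R x
  rcases R with R | R
  · rfl
  · exact propext ⟨hle n (.right R) x, hext n (.right R) id x⟩

theorem CombVal.left_congr {a : Naming P} {b : Naming Q} {V W : CombVal a b M}
    (hle : ∀ n c x, W n c x → V n c x)
    (hext : ∀ n (c : CombRel A B a.T b.T n), ¬ c.IsHead → ∀ x, V n c x → W n c x) :
    W.left = V.left := by
  funext n R x
  rcases R with R | R
  · rfl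
  · exact propext ⟨hle n (.left R) x, hext n (.left R) id x⟩

variable [A.Structure M] [B.Structure M]

-- Interpret `next` as a cyclic successor: its transitive closure is total, and minimality of the
-- copies is the stability of `Q`.
open scoped Fin.NatCast Fin.CommRing in
theorem exists_stable_of_finite [Finite M] [Nonempty M] (hQ : Q.StableModel M) :
    ∃ V : CombVal a b M, V.Stable := by
  obtain ⟨k, ⟨e⟩⟩ := Finite.exists_equiv_fin M
  obtain ⟨k, rfl⟩ : ∃ l, k = l + 1 :=
    Nat.exists_eq_succ_of_ne_zero (fun h => by subst h; exact (e (Classical.arbitrary M)).elim0)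
  let V : CombVal a b M := fun n c x =>
    match n, c, x with
    | n, .right R, x => structInterp B M n R x
    | _, .flag, _ => True
    | _, .next, x => e (x 1) = e (x 0) + 1
    | n, .star t, x => structInterp (L.sum B) M n (b.pred t) x
    | _, .reach, _ => True
    | _, _, _ => False
  have hr : V.right = structInterp (L.sum B) M := CombVal.right_eq fun _ _ _ => Iff.rfl
  have hs : V.starred = structInterp (L.sum B) M :=
    CombVal.starred_eq (fun _ _ _ => Iff.rfl) fun n R _ x => by rw [hr]
  have hf : V 0 .flag Fin.elim0 := True.intro
  rw [Program.stableModel_iff] at hQ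
  refine ⟨V, ?_, fun W hle hext hW n c x hx => ?_⟩
  · exact
      { star := fun _ r hrQ => by rw [hs, hr]; exact hQ.1 r hrQ
        star_le := fun _ n q x hx => by rw [hr]; exact hx
        le_star := fun _ n q x hx => by rw [hr] at hx; exact hx
        next_unique := fun _ x y z (h1 : e y = e x + 1) (h2 : e z = e x + 1) =>
          e.injective (h1.trans h2.symm)
        reach_base := fun _ _ _ _ => True.intro
        reach_step := fun _ _ _ _ _ _ => True.intro
        reach_all := fun _ _ _ => True.intro
        model := fun h => absurd hf h
        ins := fun h => absurd hf h
        emp := fun h => absurd hf h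
        dins := fun h => absurd hf h
        der := fun h => absurd hf h
        ok := fun h => absurd hf h
        support := fun h => absurd hf h }
  · have hfW : W 0 .flag Fin.elim0 := hext _ .flag id _ hf
    have hWr := CombVal.right_congr hle hext
    cases c with
    | star t =>
      have hsW : ∀ n (R : (L.sum B).Relations n) x, structInterp (L.sum B) M n R x →
          W.starred n R x := by
        refine hQ.2 W.starred (fun n R x h => ?_) (fun n R hR x h => ?_) fun r hrQ => ?_
        · by_cases hR : Q.Intensional R
          · obtain ⟨t, rfl⟩ := b.exists_pred hR
            exact hle _ (.star t) _ ((Naming.override_pred _ _ _ _ _).1 h)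
          · rw [CombVal.starred, Naming.override_of_not _ _ _ hR, hWr, hr] at h
            exact h
        · rw [CombVal.starred, Naming.override_of_not _ _ _ hR, hWr, hr]
          exact h
        · rw [← hr]
          exact hW.star hfW r hrQ
      exact (Naming.override_pred _ _ _ _ _).1 (hsW _ _ _ hx)
    | reach =>
      have hnext : ∀ y, W 2 .next ![y, e.symm (e y + 1)] := fun y =>
        hext _ .next id _ (e.apply_symm_apply _)
      have hreach : ∀ l : ℕ, W 2 .reach ![x 0, e.symm (e (x 0) + (l : Fin (k + 1)) + 1)] := by
        intro l
        induction l with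
        | zero => simpa using hW.reach_base hfW _ _ (hnext (x 0))
        | succ l ih =>
          have := hW.reach_step hfW _ _ _ ih (hnext _)
          simpa [add_assoc] using this
      -- `reach` requires at least one edge, whence the `- 1` in the number of further steps around
      -- the cycle.
      have := hreach (e (x 1) - e (x 0) - 1 : Fin (k + 1)).val
      rw [Fin.cast_val_eq_self, show e (x 0) + (e (x 1) - e (x 0) - 1) + 1 = e (x 1) by abel,
        e.symm_apply_apply] at this
      have hx : x = ![x 0, x 1] := by funext i; fin_cases i <;> rfl
      rwa [hx]
    | der => exact hx.elim
    | dins p => exact hx.elim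
    | ok p => exact hx.elim
    | _ => exact hext _ _ id _ hx

/-- Under a coding of all finite sets, the auxiliary predicates receive their intended meanings.
Induction on derivations shows that the derivability predicates are least. -/
theorem exists_stable_of_infinite [Infinite M] (hP : P.StableModel M) :
    ∃ V : CombVal a b M, V.Stable := by
  classical
  obtain ⟨g, hg⟩ := exists_surjective_finset_groundAtom a M
  let V : CombVal a b M := fun n c x =>
    match n, c, x with
    | n, .left R, x => structInterp A M n R x
    | _, .mem (n := n) p, x => (⟨n, p, Fin.tail x⟩ : GroundAtom a M) ∈ g (x 0)
    | _, .ins (n := n) p, x =>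
      g (x 1) ⊆ insert (⟨n, p, Fin.tail (Fin.tail x)⟩ : GroundAtom a M) (g (x 0))
    | _, .emp, x => ∀ c ∈ g (x 0), ¬ c.True
    | _, .der, x => Derives a M (g (x 0))
    | _, .dins (n := n) p, x => Derives a M (insert ⟨n, p, Fin.tail x⟩ (g (x 0)))
    | _, .ok (n := n) p, x => ∃ e, (∀ c ∈ g e, ¬ c.True) ∧ Derives a M (insert ⟨n, p, x⟩ (g e))
    | _, _, _ => False
  have hl : V.left = structInterp (L.sum A) M := CombVal.left_eq fun _ _ _ => Iff.rfl
  have hf : ¬ V 0 .flag Fin.elim0 := id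
  refine ⟨V, ?_, fun W hle hext hW => ?_⟩
  · exact
      { star := fun h => absurd h hf
        star_le := fun h => absurd h hf
        le_star := fun h => absurd h hf
        next_unique := fun h => absurd h hf
        reach_base := fun h => absurd h hf
        reach_step := fun h => absurd h hf
        reach_all := fun h => absurd h hf
        model := fun _ r hr s hs => by
          rw [hl] at hs ⊢
          exact hP.1 r hr s hs
        ins := fun _ n p m q d d' x y h1 h2 h3 =>
          ((Finset.mem_insert.1 (h1 h2)).resolve_right h3).symm
        emp := fun _ n p e x h1 h2 h3 => by
          rw [hl] at h3
          exact h1 _ h2 h3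
        dins := fun _ n p d d' x h1 h2 => h2.mono h1
        der := fun _ r hr s d hb hh => by
          refine Derives.step r hr s _ (fun l hlb => ?_) (fun c hc p hp => ?_) fun c hc p hp => ?_
          · have := hb l hlb
            rw [hl] at this
            refine Literal.holds_of_imp this fun c _ h => ?_
            by_cases hR : P.Intensional c.pred
            · obtain ⟨p, hp⟩ := a.exists_pred hR
              rw [PredAtom.Holds, ← hp, Naming.override_pred]
              trivial
            · rw [PredAtom.Holds, CombVal.tagged, Naming.override_of_not _ _ _ hR, hl] at h
              rwa [PredAtom.Holds, Naming.override_of_not _ _ _ hR]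
          · have : c.Holds (V.tagged (fun _ p => .dins p) d) s := hb _ hc
            rw [PredAtom.Holds, ← hp, CombVal.tagged, Naming.override_pred] at this
            exact this
          · have := hh c hc
            rw [PredAtom.Holds, ← hp, CombVal.tagged, Naming.override_pred] at this
            exact this
        ok := fun _ n p e x h1 h2 => ⟨e, h1, h2⟩
        support := fun _ n p x hx => by
          rw [hl] at hx
          obtain ⟨D, hD, hder⟩ := hP.exists_derives (⟨n, p, x⟩ : GroundAtom a M) hx
          -- Code only the false atoms of `D`; the one possible true atom `c₀` is put back by the
          -- insertion in `ok`.
          obtain ⟨e, he⟩ := hg (D.filter fun c => ¬ c.True)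
          refine ⟨e, fun c hc => ?_, hder.mono fun c hc => ?_⟩
          · rw [he] at hc
            exact (Finset.mem_filter.1 hc).2
          · rw [he, Finset.mem_insert, Finset.mem_filter]
            by_cases ht : c.True
            · exact Or.inl (hD c hc ht)
            · exact Or.inr ⟨hc, ht⟩ }
  · have hWl := CombVal.left_congr hle hext
    -- Surjectivity of `g` supplies a code of the enlarged set, through which `W` is forced to
    -- contain `dins`.
    have hdins : ∀ (n : ℕ) (p : a.T n) (x : Fin n → M) (d : M),
        (∀ d', g d' = insert ⟨n, p, x⟩ (g d) → W 1 .der ![d']) →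
        W _ (.dins p) (Fin.cons d x) := by
      intro n p x d h
      obtain ⟨d', hd'⟩ := hg (insert ⟨n, p, x⟩ (g d))
      exact hW.dins hf n p d d' x (hext _ (.ins p) id _ hd'.subset) (h d' hd')
    have hder : ∀ D, Derives a M D → ∀ d, g d = D → W 1 .der ![d] := by
      intro D hD
      induction hD with
      | step r hr s D hlit hbody hhead ih =>
        rintro d rfl
        refine hW.der hf r hr s d (fun l hlb => ?_) fun c hc => ?_
        · rw [hl]
          refine Literal.holds_of_imp (hlit l hlb) fun c hlc h => ?_
          by_cases hR : P.Intensional c.pred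
          · obtain ⟨p, hp⟩ := a.exists_pred hR
            rw [PredAtom.Holds, ← hp, CombVal.tagged, Naming.override_pred]
            exact hdins _ _ _ _ (ih c (hlc ▸ hlb) p hp)
          · rw [PredAtom.Holds, Naming.override_of_not _ _ _ hR] at h
            rwa [PredAtom.Holds, CombVal.tagged, Naming.override_of_not _ _ _ hR, hWl, hl]
        · obtain ⟨p, hp⟩ := a.exists_pred (Program.intensional_of_mem_head hr hc)
          rw [PredAtom.Holds, ← hp, CombVal.tagged, Naming.override_pred]
          exact hext _ (.mem p) id _ (hhead c hc p hp)
    intro n c x hx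
    cases c with
    | der =>
      have := hder _ hx (x 0) rfl
      rwa [show x = ![x 0] by funext i; fin_cases i; rfl]
    | dins p =>
      rw [← Fin.cons_self_tail x]
      exact hdins _ p _ _ fun d' hd' => hder _ hx d' hd'
    | ok p =>
      obtain ⟨e, he, hx⟩ := hx
      exact hW.ok hf _ p e x (hext _ .emp id _ he) (hdins _ p _ _ fun d' hd' => hder _ hx d' hd')
    | star t => exact hx.elim
    | reach => exact hx.elim
    | _ => exact hext _ _ id _ hx

end LogicProgram

/-! ### The combined sentence and the equivalence -/

namespace LogicProgram

variable {L : FirstOrder.Language.{u, v}}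

/-- The normal sentence which says that the structure is finite and satisfies `ψ`, or that `φ` is
witnessed by a coding of finite sets of ground atoms. -/
def combSentence (φ ψ : ProgSentence L) (a : Naming φ.program) (b : Naming ψ.program) :
    ProgSentence L :=
  have := φ.aux_relational
  have := ψ.aux_relational
  have := φ.aux_finite
  have := ψ.aux_finite
  have := a.finite
  have := b.finite
  { aux := combLang φ.aux ψ.aux a.T b.T
    aux_relational := inferInstance
    aux_finite := finite_combRel
    program := combProgram a b }

variable {φ ψ : ProgSentence L} (a : Naming φ.program) (b : Naming ψ.program)

/-- The structure on the auxiliary predicates given by an interpretation. -/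
abbrev relStructure {C : FirstOrder.Language.{0, 0}} {M : Type w} (h : C.IsRelational)
    (I : PredInterp C M) : C.Structure M :=
  ⟨fun {n} f => (h n).elim f, fun {n} R => I n R⟩

theorem exists_stable_of_models {A : Struct.{u, v, w} L} (h : (combSentence φ ψ a b).Models A) :
    ∃ (_ : φ.aux.Structure A.carrier) (_ : ψ.aux.Structure A.carrier)
      (V : CombVal a b A.carrier),
      (∀ n R x, V n (.left R) x ↔ structInterp φ.aux A.carrier n R x) ∧
      (∀ n R x, V n (.right R) x ↔ structInterp ψ.aux A.carrier n R x) ∧ V.Stable := by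
  have := φ.aux_relational
  have := ψ.aux_relational
  obtain ⟨i, hi⟩ := h
  let i' : (combLang φ.aux ψ.aux a.T b.T).Structure A.carrier := i
  let V : CombVal a b A.carrier := structInterp (combLang φ.aux ψ.aux a.T b.T) A.carrier
  let iA : φ.aux.Structure A.carrier := relStructure φ.aux_relational fun n R x => V n (.left R) x
  let iB : ψ.aux.Structure A.carrier :=
    relStructure ψ.aux_relational fun n R x => V n (.right R) x
  exact ⟨iA, iB, V, fun _ _ _ => Iff.rfl, fun _ _ _ => Iff.rfl,
    (stableModel_combProgram_iff fun _ _ _ => Iff.rfl).1 hi⟩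

theorem CombVal.Stable.models {A : Struct.{u, v, w} L} [φ.aux.Structure A.carrier]
    [ψ.aux.Structure A.carrier] {V : CombVal a b A.carrier} (hV : V.Stable) :
    (combSentence φ ψ a b).Models A := by
  have := φ.aux_relational
  have := ψ.aux_relational
  let i : (combLang φ.aux ψ.aux a.T b.T).Structure A.carrier := relStructure inferInstance V
  exact ⟨i, (stableModel_combProgram_iff fun _ _ _ => Iff.rfl).2 hV⟩

/-- If `ψ` is equivalent to `φ` over finite structures, then the combined sentence is equivalent to
`φ` over all structures. -/
theorem combSentence_models_iff
    (h : ∀ A : Struct.{u, v, w} L, Finite A.carrier → (φ.Models A ↔ ψ.Models A))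
    (A : Struct.{u, v, w} L) : (combSentence φ ψ a b).Models A ↔ φ.Models A := by
  constructor
  · intro hA
    obtain ⟨iA, iB, V, hl, hr, hV⟩ := exists_stable_of_models a b hA
    by_cases hf : V 0 .flag Fin.elim0
    · exact (h A (hV.finite hf)).2 ⟨iB, hV.right_stable hf hr⟩
    · exact ⟨iA, hV.left_stable hf hl⟩
  · intro hA
    cases finite_or_infinite A.carrier with
    | inl hfin =>
      obtain ⟨iB, hB⟩ := (h A hfin).1 hA
      -- With `flag`, the predicates of `P` are unconstrained, so any interpretation serves.
      let iA : φ.aux.Structure A.carrier := relStructure φ.aux_relational fun _ _ _ => False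
      obtain ⟨V, hV⟩ := exists_stable_of_finite a b hB
      exact hV.models
    | inr hinf =>
      obtain ⟨iA, hA⟩ := hA
      let iB : ψ.aux.Structure A.carrier := relStructure ψ.aux_relational fun _ _ _ => False
      obtain ⟨V, hV⟩ := exists_stable_of_infinite a b hA
      exact hV.models

theorem combSentence_mem_NLP (hφ : φ ∈ DLP L) (hψ : ψ ∈ NLP L) :
    combSentence φ ψ a b ∈ NLP L := by
  have := φ.aux_relational
  have := ψ.aux_relational
  have := φ.aux_finite
  have := ψ.aux_finite
  exact ⟨finite_combProgram a b hφ hψ.1, isNormal_combProgram a b hψ.2⟩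

theorem exprLE_NLP_DLP (C : StructClass.{u, v, w}) : ExprLE C NLP.{u, v} DLP.{u, v} :=
  fun _ _ ⟨φ, hφ, h⟩ => ⟨φ, hφ.1, h⟩

end LogicProgram

theorem mainTheorem3 :
    LogicProgram.ExprEquiv LogicProgram.ARB.{u, v, w} LogicProgram.DLP.{u, v}
        LogicProgram.NLP.{u, v} ↔
      LogicProgram.ExprEquiv LogicProgram.FIN.{u, v, w} LogicProgram.DLP.{u, v}
        LogicProgram.NLP.{u, v} := by
  refine ⟨fun h => ⟨fun L D => ?_, LogicProgram.exprLE_NLP_DLP _⟩,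
    fun h => ⟨fun L D => ?_, LogicProgram.exprLE_NLP_DLP _⟩⟩
  · rintro ⟨φ, hφ, hD⟩
    -- `D` is arbitrary on infinite structures, so the hypothesis is applied to the class of all
    -- models of `φ`.
    obtain ⟨ψ, hψ, hψφ⟩ := h.1 L {A | φ.Models A} ⟨φ, hφ, fun A _ => Iff.rfl⟩
    exact ⟨ψ, hψ, fun A hA => (hD A hA).trans (hψφ A trivial)⟩
  · rintro ⟨φ, hφ, hD⟩
    obtain ⟨ψ, hψ, hψφ⟩ := h.1 L {A | φ.Models A} ⟨φ, hφ, fun A _ => Iff.rfl⟩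
    obtain ⟨a⟩ := LogicProgram.exists_naming hφ
    obtain ⟨b⟩ := LogicProgram.exists_naming hψ.1
    exact ⟨LogicProgram.combSentence φ ψ a b, LogicProgram.combSentence_mem_NLP a b hφ hψ,
      fun A hA => (hD A hA).trans
        (LogicProgram.combSentence_models_iff a b (fun A hA => hψφ A hA) A).symm⟩
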